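/- Let $n\ge 3$ and $H(x)=x_1^2+\cdots+x_n^2-x_1x_2\cdots x_n$ for $x\in\mathbb C^n$. Let $\Gamma_n=\langle b_1,\dots,b_n\mid b_1^2=\cdots=b_n^2=1\rangle$ act on $\mathbb C^n$, where $b_i$ replaces the coordinate $x_i$ by $\prod_{j\ne i}x_j-x_i$ and fixes the other coordinates. Let $\Delta$ be the Cayley tree of $\Gamma_n$: its vertices are the elements of $\Gamma_n$, and $g,h$ are joined by an edge labelled $i$ if and only if $g=hb_i$. For $1\le i<j\le n$, an alternating $\{i,j\}$-geodesic is a connected component of the graph obtained from $\Delta$ by keeping all vertices and only the edges labelled $i$ or $j$ (a bi-infinite geodesic whose edges are labelled alternately $i$ and $j$). Let $\mathcal A$ be the set of all alternating geodesics, over all pairs $i<j$. For $a\in\mathbb C^n$ and a vertex $g$ let $\Phi_a(g)=g^{-1}(a)$. If $\gamma$ is an alternating $\{i,j\}$-geodesic, $g$ is a vertex of $\gamma$ and $\Phi_a(g)=(x_1,\dots,x_n)$, put $$\phi(\gamma)=\prod_{k\ne i,j}x_k,\qquad \sigma(\gamma)=\sum_{k\ne i,j}x_k^2 ;$$ these do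 not depend on the choice of $g$. Let $\mathcal D\subset\mathbb C^n$ be the set of all $a$ such that (i) $\phi(\gamma)\notin[-2,2]$ for all $\gamma\in\mathcal A$, and (ii) for some real $K>2$ the set $\{\gamma\in\mathcal A: |\phi(\gamma)|\le K\}$ is finite. **Theorem.** Let $a\in\mathcal D$ and $\mu=H(a)$. Then $\sigma(\gamma)\ne\mu$ for all $\gamma\in\mathcal A$, so that $$\mathfrak h_\mu(\gamma)=1-\Bigl(1+\frac{2\mu}{n(n-1)(\sigma(\gamma)-\mu)}\Bigr)\sqrt{1-\frac{4}{\phi(\gamma)^2}}$$ is defined for all $\gamma\in\mathcal A$, where the square root is the one with non-negative real part; the series $\sum_{\gamma\in\mathcal A}\mathfrak h_\mu(\gamma)$ converges absolutely, and $$\sum_{\gamma\in\mathcal A}\mathfrak h_\mu(\gamma)=1 .$$ In particular, if $\mu=0$, then $\sum_{\gamma\in\mathcal A}h(\phi(\gamma))=1$ with absolute convergence, where $h(z)=1-\sqrt{1-4/z^2}$ for $z\ne 0$. -/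

import Mathlib

namespace MarkoffHurwitz

/-- The Markoff-Hurwitz polynomial `x₁² + ⋯ + xₙ² - x₁ ⋯ xₙ`. -/
def hurwitzPoly {n : ℕ} (x : Fin n → ℂ) : ℂ :=
  (∑ i, x i ^ 2) - ∏ i, x i

/-- The map of `ℂⁿ` that replaces `xᵢ` by the product of the other coordinates minus `xᵢ`. -/
def flipAt {n : ℕ} (i : Fin n) (x : Fin n → ℂ) : Fin n → ℂ :=
  Function.update x i ((∏ j ∈ Finset.univ.erase i, x j) - x i)

theorem flipAt_flipAt {n : ℕ} (i : Fin n) (x : Fin n → ℂ) : flipAt i (flipAt i x) = x := by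
  have h : ∏ j ∈ Finset.univ.erase i, flipAt i x j = ∏ j ∈ Finset.univ.erase i, x j :=
    Finset.prod_congr rfl fun j hj => by
      simp [flipAt, Function.update_of_ne (Finset.ne_of_mem_erase hj)]
  funext k
  by_cases hk : k = i
  · subst hk
    have : flipAt k (flipAt k x) k = ∏ j ∈ Finset.univ.erase k, flipAt k x j - flipAt k x k := by
      simp [flipAt]
    rw [this, h]
    simp [flipAt]
  · simp [flipAt, Function.update_of_ne hk]

/-- The involution `flipAt i` as a permutation of `ℂⁿ`. -/
def flipPerm {n : ℕ} (i : Fin n) : Equiv.Perm (Fin n → ℂ) where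
  toFun := flipAt i
  invFun := flipAt i
  left_inv := flipAt_flipAt i
  right_inv := flipAt_flipAt i

/-- The relators `bᵢ²`, for `i = 1, …, n`. -/
def relators (n : ℕ) : Set (FreeGroup (Fin n)) :=
  Set.range fun i => FreeGroup.of i ^ 2

/-- The group `Γₙ = ⟨b₁, …, bₙ | b₁² = ⋯ = bₙ² = 1⟩`. -/
abbrev Gam (n : ℕ) : Type := PresentedGroup (relators n)

/-- The generator `bᵢ` of `Γₙ`. -/
def gen {n : ℕ} (i : Fin n) : Gam n := PresentedGroup.of i

theorem gen_mul_self {n : ℕ} (i : Fin n) : gen i * gen i = 1 := by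
  have h : PresentedGroup.mk (relators n) (FreeGroup.of i ^ 2) = 1 :=
    PresentedGroup.one_of_mem ⟨i, rfl⟩
  rw [pow_two, map_mul] at h
  exact h

theorem gen_inv {n : ℕ} (i : Fin n) : (gen i)⁻¹ = gen i :=
  inv_eq_of_mul_eq_one_left (gen_mul_self i)

theorem gen_ne_one {n : ℕ} (i : Fin n) : gen i ≠ 1 := by
  have hr : ∀ r ∈ relators n,
      FreeGroup.lift (fun _ : Fin n => Multiplicative.ofAdd (1 : ZMod 2)) r = 1 := by
    rintro _ ⟨j, rfl⟩
    simp only [map_pow, FreeGroup.lift_apply_of]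
    decide
  intro h
  have h2 : PresentedGroup.toGroup hr (gen i) = 1 := by rw [h, map_one]
  have h3 : PresentedGroup.toGroup hr (gen i) = Multiplicative.ofAdd (1 : ZMod 2) :=
    PresentedGroup.toGroup.of hr
  exact absurd (h3.symm.trans h2) (by decide)

/-- The action of `Γₙ` on `ℂⁿ`, in which `bᵢ` acts as `flipAt i`. -/
def act (n : ℕ) : Gam n →* Equiv.Perm (Fin n → ℂ) :=
  PresentedGroup.toGroup (f := flipPerm) (by
    rintro _ ⟨i, rfl⟩
    rw [map_pow, FreeGroup.lift_apply_of, pow_two]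
    ext1 x
    exact flipAt_flipAt i x)

theorem act_gen {n : ℕ} (i : Fin n) (x : Fin n → ℂ) : act n (gen i) x = flipAt i x := by
  simp only [act, gen, PresentedGroup.toGroup.of]
  rfl

/-- The graph on the vertex set `Γₙ` whose edges are the edges of the Cayley tree of `Γₙ` with
label in `I`: the vertices `g` and `h` are joined by an `i`-edge iff `g = h bᵢ`. For `I` the
set of all labels it is the Cayley tree itself. -/
def colorGraph {n : ℕ} (I : Finset (Fin n)) : SimpleGraph (Gam n) where
  Adj g h := ∃ i ∈ I, g = h * gen i
  symm := ⟨by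
    rintro g h ⟨i, hi, rfl⟩
    exact ⟨i, hi, by rw [mul_assoc, gen_mul_self, mul_one]⟩⟩
  loopless := ⟨by
    rintro g ⟨i, -, hi⟩
    exact gen_ne_one i (left_eq_mul.mp hi)⟩

/-- The set of alternating geodesics of the Cayley tree: an alternating geodesic consists of a
set `I = {i, j}` of two labels and a connected component of the graph formed by all vertices
and the edges labelled `i` or `j`. -/
abbrev AltGeod (n : ℕ) : Type :=
  Σ I : {I : Finset (Fin n) // I.card = 2}, (colorGraph I.1).ConnectedComponent

/-- The vector-valued Hurwitz map `g ↦ g⁻¹(a)` on the vertices of the Cayley tree. -/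
def orbitMap {n : ℕ} (a : Fin n → ℂ) (g : Gam n) : Fin n → ℂ := act n g⁻¹ a

/-- Along edges with labels in `I`, the coordinates outside `I` do not change. -/
theorem orbitMap_eq_of_walk {n : ℕ} (a : Fin n → ℂ) (I : Finset (Fin n)) {g h : Gam n}
    (p : (colorGraph I).Walk g h) {k : Fin n} (hk : k ∉ I) :
    orbitMap a g k = orbitMap a h k := by
  induction p with
  | nil => rfl
  | @cons u v w huv p ih =>
    rw [← ih]
    obtain ⟨i, hi, rfl⟩ := huv
    have hki : k ≠ i := fun h => hk (h ▸ hi)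
    simp only [orbitMap, mul_inv_rev, gen_inv, map_mul, Equiv.Perm.mul_apply, act_gen]
    simp [flipAt, Function.update_of_ne hki]

/-- The extended Hurwitz map: `φ(γ)` is the product of `x_k` over `k ≠ i, j`, for an alternating
`{i, j}`-geodesic `γ` and the vector `x` at any vertex of `γ`. -/
def phi {n : ℕ} (a : Fin n → ℂ) (γ : AltGeod n) : ℂ :=
  γ.2.lift (fun g => ∏ k ∈ γ.1.1ᶜ, orbitMap a g k) fun _ _ p _ =>
    Finset.prod_congr rfl fun _ hk => orbitMap_eq_of_walk a _ p (Finset.mem_compl.mp hk)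

/-- The square sum weight: `σ(γ)` is the sum of `x_k²` over `k ≠ i, j`, for an alternating
`{i, j}`-geodesic `γ` and the vector `x` at any vertex of `γ`. -/
def sigma {n : ℕ} (a : Fin n → ℂ) (γ : AltGeod n) : ℂ :=
  γ.2.lift (fun g => ∑ k ∈ γ.1.1ᶜ, orbitMap a g k ^ 2) fun _ _ p _ =>
    Finset.sum_congr rfl fun _ hk => by
      rw [orbitMap_eq_of_walk a _ p (Finset.mem_compl.mp hk)]

/-- The set `𝒟` of the `a ∈ ℂⁿ` such that `φ` takes no value in the real segment `[-2, 2]`, and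
for some `K > 2` there are only finitely many alternating geodesics with `|φ(γ)| ≤ K`. -/
def domainD (n : ℕ) : Set (Fin n → ℂ) :=
  {a | (∀ γ : AltGeod n, phi a γ ∉ Complex.ofReal '' Set.Icc (-2) 2) ∧
    ∃ K : ℝ, 2 < K ∧ {γ : AltGeod n | ‖phi a γ‖ ≤ K}.Finite}

/-- The square root with non-negative real part (the principal branch). -/
noncomputable def csqrt (z : ℂ) : ℂ := z ^ (1 / 2 : ℂ)

theorem csqrt_sq (z : ℂ) : csqrt z ^ 2 = z := by
  rw [csqrt, one_div]
  exact Complex.cpow_nat_inv_pow z two_ne_zero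

theorem csqrt_re_nonneg (z : ℂ) : 0 ≤ (csqrt z).re := by
  rcases eq_or_ne z 0 with rfl | hz
  · simp [csqrt]
  · rw [csqrt, Complex.cpow_def_of_ne_zero hz, Complex.exp_re]
    have him : (Complex.log z * (1 / 2 : ℂ)).im = z.arg / 2 := by
      rw [show (1 / 2 : ℂ) = ((1 / 2 : ℝ) : ℂ) by norm_num, Complex.im_mul_ofReal,
        Complex.log_im]
      ring
    rw [him]
    have h1 := Complex.neg_pi_lt_arg z
    have h2 := Complex.arg_le_pi z
    exact mul_nonneg (Real.exp_pos _).le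
      (Real.cos_nonneg_of_neg_pi_div_two_le_of_le (by linarith) (by linarith))

/-- `h(z) = 1 - √(1 - 4 / z²)`. -/
noncomputable def hfun (z : ℂ) : ℂ := 1 - csqrt (1 - 4 / z ^ 2)

/-- The summand `1 - (1 + 2μ / (n(n-1)(σ(γ) - μ))) √(1 - 4 / φ(γ)²)`. -/
noncomputable def hmu {n : ℕ} (μ : ℂ) (a : Fin n → ℂ) (γ : AltGeod n) : ℂ :=
  1 - (1 + 2 * μ / ((n : ℂ) * ((n : ℂ) - 1) * (sigma a γ - μ))) *
    csqrt (1 - 4 / phi a γ ^ 2)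

end MarkoffHurwitz

/-! Reduced words label the vertices of the Cayley tree. Along an alternating geodesic `γ` the
moving coordinates satisfy `u (k + 2) = φ(γ) * u (k + 1) - u k`, so they grow geometrically in both
directions because `φ(γ) ∉ [-2, 2]`. The finiteness of `{γ | ‖φ(γ)‖ ≤ K}` makes the growth uniform
over the tree, so that `1 / (x₁ ⋯ xₙ)` is summable over the vertices; call its sum `S`.

The sum of `h(φ(γ))` over the geodesics that come within distance `N` of the root telescopes, up to
a vanishing error, to a sum over the edges at distance `N`. There it is compared with the sum of
`(x₁² + ⋯ + xₙ²) / (x₁ ⋯ xₙ) - 1`, which by invariance of `H` is `μ / (x₁ ⋯ xₙ)`; this gives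
`∑ h(φ(γ)) = 1 + μ S`. Along one geodesic the sum of `1 / (x₁ ⋯ xₙ)` telescopes as well, to
`√(1 - 4 / φ(γ)²) / (σ(γ) - μ)`. Each vertex lies on `n (n - 1) / 2` geodesics, so these add up to
`n (n - 1) / 2 * S`, and the correction term of `𝔥_μ` removes exactly `μ S`. -/

namespace MarkoffHurwitz

open Filter Finset Topology

theorem hasSum_comp_snd {ι κ M : Type*} [Fintype ι] [AddCommMonoid M] [TopologicalSpace M]
    [ContinuousAdd M] {f : κ → M} {S : M} (h : HasSum f S) :
    HasSum (fun p : ι × κ => f p.2) (Fintype.card ι • S) := by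
  classical
  have hslice (i : ι) : HasSum (fun p : ι × κ => if p.1 = i then f p.2 else 0) S := by
    refine ((Prod.mk_right_injective i).hasSum_iff ?_).mp (by simpa [Function.comp_def] using h)
    rintro ⟨j, k⟩ hj
    exact if_neg fun hji : j = i => hj ⟨k, by rw [hji]⟩
  simpa using hasSum_sum fun i (_ : i ∈ univ) => hslice i

section LinearRecurrence

variable {𝕜 : Type*} [NormedField 𝕜] {b : 𝕜} {u : ℕ → 𝕜}

theorem recurrence_growing_part (hb : b ≠ 0)
    (hu : ∀ k, u (k + 2) = (b + b⁻¹) * u (k + 1) - u k) (k : ℕ) :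
    b * u (k + 1) - u k = b ^ k * (b * u 1 - u 0) := by
  induction k with
  | zero => simp
  | succ k ih =>
    rw [hu, pow_succ', mul_assoc, ← ih]
    field_simp
    ring

theorem recurrence_decaying_part (hb : b ≠ 0)
    (hu : ∀ k, u (k + 2) = (b + b⁻¹) * u (k + 1) - u k) (k : ℕ) :
    u (k + 1) - b * u k = b⁻¹ ^ k * (u 1 - b * u 0) := by
  induction k with
  | zero => simp
  | succ k ih =>
    rw [hu, pow_succ', mul_assoc, ← ih]
    field_simp
    ring

theorem tendsto_norm_recurrence_atTop (hb : 1 < ‖b‖)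
    (hu : ∀ k, u (k + 2) = (b + b⁻¹) * u (k + 1) - u k) (hd : b * u 1 ≠ u 0) :
    Tendsto (fun k => ‖u k‖) atTop atTop := by
  have hb0 : b ≠ 0 := norm_pos_iff.mp (one_pos.trans hb)
  set d := b * u 1 - u 0 with hd_def
  set e := u 1 - b * u 0 with he_def
  have hd0 : 0 < ‖d‖ := norm_pos_iff.mpr (sub_ne_zero.mpr hd)
  have hclosed (k : ℕ) : (b ^ 2 - 1) * u k = b ^ k * d - b * (b⁻¹ ^ k * e) := by
    rw [hd_def, he_def, ← recurrence_growing_part hb0 hu, ← recurrence_decaying_part hb0 hu]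
    ring
  have hlower (k : ℕ) : ‖b‖ ^ k * ‖d‖ - ‖b‖ * ‖e‖ ≤ ‖b ^ 2 - 1‖ * ‖u k‖ := by
    have hdecay : ‖b⁻¹ ^ k * e‖ ≤ ‖e‖ := by
      rw [norm_mul, norm_pow, norm_inv]
      exact mul_le_of_le_one_left (norm_nonneg _) (pow_le_one₀ (by positivity)
        (inv_le_one_of_one_le₀ hb.le))
    calc ‖b‖ ^ k * ‖d‖ - ‖b‖ * ‖e‖ ≤ ‖b ^ k * d‖ - ‖b * (b⁻¹ ^ k * e)‖ := by
          rw [norm_mul b, norm_mul (b ^ k), norm_pow]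
          gcongr
      _ ≤ ‖b ^ k * d - b * (b⁻¹ ^ k * e)‖ := norm_sub_norm_le _ _
      _ = ‖b ^ 2 - 1‖ * ‖u k‖ := by rw [← hclosed, norm_mul]
  have hpos : 0 < ‖b ^ 2 - 1‖ := by
    refine norm_pos_iff.mpr (sub_ne_zero.mpr fun h => ?_)
    have := one_lt_pow₀ hb two_ne_zero
    rw [← norm_pow, h, norm_one] at this
    exact lt_irrefl _ this
  have hpow : Tendsto (fun k => ‖b‖ ^ k * ‖d‖ - ‖b‖ * ‖e‖) atTop atTop :=
    tendsto_atTop_add_const_right _ _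
      ((tendsto_pow_atTop_atTop_of_one_lt hb).atTop_mul_const hd0)
  exact (tendsto_const_mul_atTop_of_pos hpos).mp (tendsto_atTop_mono hlower hpow)

theorem tendsto_recurrence_zero (hb : 1 < ‖b‖)
    (hu : ∀ k, u (k + 2) = (b + b⁻¹) * u (k + 1) - u k) (hd : b * u 1 = u 0) :
    Tendsto u atTop (𝓝 0) := by
  have hb0 : b ≠ 0 := norm_pos_iff.mp (one_pos.trans hb)
  have hdecay (k : ℕ) : u k = b⁻¹ ^ k * u 0 := by
    induction k with
    | zero => simp
    | succ k ih =>
      have hstep := recurrence_growing_part hb0 hu k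
      rw [sub_eq_zero.mpr hd, mul_zero, sub_eq_zero] at hstep
      rw [pow_succ', mul_assoc, ← ih, ← hstep, inv_mul_cancel_left₀ hb0]
  have hpow : Tendsto (fun k => b⁻¹ ^ k) atTop (𝓝 0) :=
    tendsto_pow_atTop_nhds_zero_of_norm_lt_one
      (by rw [norm_inv]; exact inv_lt_one_of_one_lt₀ hb)
  simpa only [← hdecay, zero_mul] using hpow.mul_const (u 0)

theorem eventually_mul_norm_recurrence_le (hb : 1 < ‖b‖)
    (hu : ∀ k, u (k + 2) = (b + b⁻¹) * u (k + 1) - u k) (hd : b * u 1 ≠ u 0)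
    {ρ : ℝ} (hρ : ρ < ‖b‖) : ∀ᶠ k in atTop, ρ * ‖u k‖ ≤ ‖u (k + 1)‖ := by
  have hb0 : b ≠ 0 := norm_pos_iff.mp (one_pos.trans hb)
  have hlarge : ∀ᶠ k in atTop, ‖u 1 - b * u 0‖ ≤ (‖b‖ - ρ) * ‖u k‖ :=
    ((tendsto_norm_recurrence_atTop hb hu hd).const_mul_atTop
      (sub_pos.mpr hρ)).eventually_ge_atTop _
  filter_upwards [hlarge] with k hk
  have hdecay : ‖u (k + 1) - b * u k‖ ≤ ‖u 1 - b * u 0‖ := by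
    rw [recurrence_decaying_part hb0 hu, norm_mul, norm_pow, norm_inv]
    exact mul_le_of_le_one_left (norm_nonneg _) (pow_le_one₀ (by positivity)
      (inv_le_one_of_one_le₀ hb.le))
  have htri : ‖b * u k‖ ≤ ‖u (k + 1)‖ + ‖u (k + 1) - b * u k‖ := norm_le_insert (u (k + 1)) _
  rw [norm_mul] at htri
  linarith

/-- The sum telescopes: with `dₖ = bᵏ (b u₁ - u₀)` the `k`-th summand is the difference of
`(uₖ₊₁ dₖ)⁻¹` and `(uₖ₊₂ dₖ₊₁)⁻¹`. -/
theorem hasSum_inv_mul_recurrence [CompleteSpace 𝕜] (hb : 1 < ‖b‖)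
    (hu : ∀ k, u (k + 2) = (b + b⁻¹) * u (k + 1) - u k) (hd : b * u 1 ≠ u 0)
    (hne : ∀ k, u (k + 1) ≠ 0) :
    HasSum (fun k => (u (k + 1) * u (k + 2))⁻¹) (u 1 * (b * u 1 - u 0))⁻¹ := by
  have hb0 : b ≠ 0 := norm_pos_iff.mp (one_pos.trans hb)
  set d := b * u 1 - u 0 with hd_def
  have hd0 : d ≠ 0 := sub_ne_zero.mpr hd
  let t (k : ℕ) : 𝕜 := (u (k + 1) * (b ^ k * d))⁻¹
  have htelescope (k : ℕ) : (u (k + 1) * u (k + 2))⁻¹ = t k - t (k + 1) := by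
    have hk := hne k
    have hk' := hne (k + 1)
    have hgrow := recurrence_growing_part hb0 hu (k + 1)
    rw [← hd_def] at hgrow
    simp only [t]
    rw [pow_succ] at hgrow ⊢
    field_simp
    linear_combination -hgrow
  have ht : Summable fun k => ‖t k‖ := by
    have hgeom : Summable fun k => (‖b‖⁻¹ ^ k) * ‖d‖⁻¹ :=
      (summable_geometric_of_lt_one (by positivity) (inv_lt_one_of_one_lt₀ hb)).mul_right _
    refine hgeom.of_norm_bounded_eventually_nat ?_
    filter_upwards [(tendsto_add_atTop_iff_nat 1).mpr (tendsto_norm_recurrence_atTop hb hu hd)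
      |>.eventually_ge_atTop 1] with k hk
    simp only [t, norm_norm, norm_inv, norm_mul, norm_pow, mul_inv, inv_pow]
    exact mul_le_of_le_one_left (by positivity) (inv_le_one_of_one_le₀ hk)
  have hsum : Summable fun k => ‖(u (k + 1) * u (k + 2))⁻¹‖ := by
    refine (ht.add ((summable_nat_add_iff 1).mpr ht)).of_nonneg_of_le
      (fun _ => norm_nonneg _) fun k => ?_
    rw [htelescope]
    exact norm_sub_le _ _
  refine (hasSum_iff_tendsto_nat_of_summable_norm hsum).mpr ?_
  have ht0 : t 0 = (u 1 * d)⁻¹ := by simp [t]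
  simpa only [htelescope, Finset.sum_range_sub', ht0, sub_zero] using
    ht.of_norm.tendsto_atTop_zero.const_sub (t 0)

end LinearRecurrence

section FinsetLemmas

theorem sum_powersetCard_two {α M : Type*} [DecidableEq α] [AddCommMonoid M] (s : Finset α)
    (F : α → α → M) (G : Finset α → M)
    (hFG : ∀ i j, i ≠ j → F i j + F j i = G {i, j}) :
    ∑ I ∈ s.powersetCard 2, G I = ∑ i ∈ s, ∑ j ∈ s.erase i, F i j := by
  have hmaps : ∀ p ∈ s.offDiag, ({p.1, p.2} : Finset α) ∈ s.powersetCard 2 := by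
    intro p hp
    obtain ⟨h₁, h₂, hne⟩ := mem_offDiag.mp hp
    exact mem_powersetCard.mpr ⟨by simp [insert_subset_iff, h₁, h₂], card_pair hne⟩
  have hfiber : ∀ I ∈ s.powersetCard 2,
      ∑ p ∈ s.offDiag with {p.1, p.2} = I, F p.1 p.2 = G I := by
    intro I hI
    obtain ⟨hIs, hcard⟩ := mem_powersetCard.mp hI
    obtain ⟨i, j, hij, rfl⟩ := card_eq_two.mp hcard
    have : s.offDiag.filter (fun p => ({p.1, p.2} : Finset α) = {i, j}) = {(i, j), (j, i)} := by
      ext ⟨p, q⟩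
      simp only [← coe_inj, coe_pair, Set.pair_eq_pair_iff, mem_filter, mem_offDiag, mem_insert,
        mem_singleton, Prod.mk.injEq]
      grind
    rw [this, sum_pair (by simp [hij]), hFG i j hij]
  rw [← sum_congr rfl hfiber, sum_fiberwise_of_maps_to hmaps, sum_finset_product]
  simp only [mem_offDiag, mem_erase]
  grind

theorem exists_pos_le_of_finite {α : Type*} {s : Set α} (hs : s.Finite) {f : α → ℝ}
    (hf : ∀ x ∈ s, 0 < f x) {C : ℝ} (hC : 0 < C) : ∃ ε, 0 < ε ∧ ε ≤ C ∧ ∀ x ∈ s, ε ≤ f x := by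
  have hfin : (insert C (f '' s)).Finite := (hs.image f).insert C
  obtain ⟨ε, hε, hmin⟩ := Set.exists_min_image _ id hfin ⟨C, Set.mem_insert _ _⟩
  refine ⟨ε, ?_, hmin C (Set.mem_insert _ _), fun x hx =>
    hmin _ (Set.mem_insert_of_mem _ (Set.mem_image_of_mem f hx))⟩
  obtain rfl | ⟨x, hx, rfl⟩ := hε
  exacts [hC, hf x hx]

end FinsetLemmas

section Words

variable {α : Type*}

/-- A word is reduced if consecutive letters differ. -/
abbrev Reduced (l : List α) : Prop := l.IsChain (· ≠ ·)

/-- The reduced words in the alphabet `α`. They grow at the head: the head of a list is the last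
letter of the word. -/
abbrev ReducedWord (α : Type*) : Type _ := {l : List α // Reduced l}

theorem suffix_induction {l : List α} {P : List α → Prop} (base : P l)
    (step : ∀ i w, l <:+ w → P w → P (i :: w)) (w : List α) (hw : l <:+ w) : P w := by
  obtain ⟨e, rfl⟩ := hw
  induction e with
  | nil => exact base
  | cons i e ih => exact step i _ ⟨e, rfl⟩ ih

theorem exists_cons_suffix {l w : List α} (h : l <:+ w) (hl : l.length < w.length) :
    ∃ i, i :: l <:+ w := by
  obtain ⟨e, rfl⟩ := h
  rcases List.eq_nil_or_concat e with rfl | ⟨e', i, rfl⟩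
  · simp at hl
  · exact ⟨i, e', by simp⟩

theorem finite_reducedWord_length_lt [Finite α] (N : ℕ) :
    {l : ReducedWord α | l.1.length < N}.Finite :=
  (List.finite_length_lt α N).preimage Subtype.val_injective.injOn

variable [Fintype α] [DecidableEq α]

/-- The letters by which a reduced word can be extended. -/
def nextLabels (l : List α) : Finset α := {i | i ∉ l.head?}

theorem mem_nextLabels {l : List α} {i : α} : i ∈ nextLabels l ↔ i ∉ l.head? := by
  simp [nextLabels]

theorem nextLabels_nil : nextLabels ([] : List α) = univ := by
  ext; simp [mem_nextLabels]

theorem nextLabels_cons (j : α) (l : List α) : nextLabels (j :: l) = univ.erase j := by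
  ext i; simp [mem_nextLabels, eq_comm]

theorem reduced_cons {l : List α} {i : α} :
    Reduced (i :: l) ↔ i ∈ nextLabels l ∧ Reduced l := by
  rw [Reduced, List.isChain_cons, mem_nextLabels]
  exact and_congr_left fun _ => ⟨fun h e => h i e rfl, fun h y hy e => h (e ▸ hy)⟩

/-- The reduced words of length `N`. -/
def wordsOfLength (α : Type*) [Fintype α] [DecidableEq α] : ℕ → Finset (List α)
  | 0 => {[]}
  | N + 1 => (wordsOfLength α N).biUnion fun l => (nextLabels l).image (· :: l)

theorem mem_wordsOfLength {N : ℕ} {l : List α} :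
    l ∈ wordsOfLength α N ↔ Reduced l ∧ l.length = N := by
  induction N generalizing l with
  | zero =>
    rw [wordsOfLength, mem_singleton, List.length_eq_zero_iff]
    exact ⟨fun h => ⟨h ▸ List.IsChain.nil, h⟩, fun h => h.2⟩
  | succ N ih =>
    simp only [wordsOfLength, mem_biUnion, mem_image, ih]
    constructor
    · rintro ⟨l', ⟨hr, rfl⟩, i, hi, rfl⟩
      exact ⟨reduced_cons.mpr ⟨hi, hr⟩, rfl⟩
    · rintro ⟨hr, hl⟩
      obtain _ | ⟨i, l⟩ := l
      · simp at hl
      · obtain ⟨hi, hr⟩ := reduced_cons.mp hr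
        exact ⟨l, ⟨hr, by simpa using hl⟩, i, hi, rfl⟩

theorem sum_wordsOfLength_zero {M : Type*} [AddCommMonoid M] (f : List α → M) :
    ∑ l ∈ wordsOfLength α 0, f l = f [] := by simp [wordsOfLength]

theorem sum_wordsOfLength_succ {M : Type*} [AddCommMonoid M] (f : List α → M) (N : ℕ) :
    ∑ l ∈ wordsOfLength α (N + 1), f l =
      ∑ l ∈ wordsOfLength α N, ∑ i ∈ nextLabels l, f (i :: l) := by
  rw [wordsOfLength, sum_biUnion]
  · exact sum_congr rfl fun l _ => sum_image fun i _ j _ h => (List.cons.inj h).1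
  · intro l _ l' _ hne
    rw [Function.onFun, disjoint_left]
    rintro _ h h'
    obtain ⟨i, -, rfl⟩ := mem_image.mp h
    obtain ⟨j, -, e⟩ := mem_image.mp h'
    exact hne (List.cons.inj e).2.symm

/-- Reduced words of prescribed length, as a fibre of the length function and as a finset. -/
def lengthFiberEquiv (α : Type*) [Fintype α] [DecidableEq α] (N : ℕ) :
    {l : ReducedWord α // l.1.length = N} ≃ wordsOfLength α N :=
  (Equiv.subtypeSubtypeEquivSubtypeInter Reduced fun l : List α => l.length = N).trans
    (Equiv.subtypeEquivRight fun _ => mem_wordsOfLength.symm)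

theorem hasSum_lengthFiber {M : Type*} [AddCommMonoid M] [TopologicalSpace M]
    (f : List α → M) (N : ℕ) :
    HasSum (fun l : {l : ReducedWord α // l.1.length = N} => f l.1.1)
      (∑ l ∈ wordsOfLength α N, f l) :=
  (lengthFiberEquiv α N).hasSum_iff.mpr ((wordsOfLength α N).hasSum f)

theorem hasSum_sum_wordsOfLength {M : Type*} [AddCommMonoid M] [TopologicalSpace M]
    [ContinuousAdd M] [RegularSpace M] {f : List α → M} {S : M}
    (h : HasSum (fun l : ReducedWord α => f l.1) S) :
    HasSum (fun N => ∑ l ∈ wordsOfLength α N, f l) S :=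
  ((Equiv.sigmaFiberEquiv fun l : ReducedWord α => l.1.length).hasSum_iff.mpr h).sigma
    fun N => hasSum_lengthFiber f N

theorem summable_reducedWord_of_nonneg {f : List α → ℝ} (hf : ∀ l, 0 ≤ f l)
    (h : Summable fun N => ∑ l ∈ wordsOfLength α N, f l) :
    Summable fun l : ReducedWord α => f l.1 := by
  refine (Equiv.sigmaFiberEquiv fun l : ReducedWord α => l.1.length).summable_iff.mp
    ((summable_sigma_of_nonneg fun _ => hf _).mpr
      ⟨fun N => (hasSum_lengthFiber f N).summable, h.congr fun N => ?_⟩)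
  exact (hasSum_lengthFiber f N).tsum_eq.symm

theorem summable_of_sum_nextLabels_le {f : List α → ℝ} (hf : ∀ l, 0 ≤ f l) {q : ℝ} (hq : q < 1)
    {N₀ : ℕ}
    (h : ∀ l, Reduced l → N₀ ≤ l.length → ∑ i ∈ nextLabels l, f (i :: l) ≤ q * f l) :
    Summable fun l : ReducedWord α => f l.1 := by
  have hlevel (N : ℕ) : 0 ≤ ∑ l ∈ wordsOfLength α N, f l := sum_nonneg fun l _ => hf l
  refine summable_reducedWord_of_nonneg hf (summable_of_ratio_norm_eventually_le hq ?_)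
  filter_upwards [eventually_ge_atTop N₀] with N hN
  rw [Real.norm_of_nonneg (hlevel _), Real.norm_of_nonneg (hlevel _), sum_wordsOfLength_succ,
    mul_sum]
  refine sum_le_sum fun l hl => ?_
  obtain ⟨hr, rfl⟩ := mem_wordsOfLength.mp hl
  exact h l hr hN

/-- Pairs of letters, indexed by the reduced words that can be extended by both letters. -/
abbrev Root (α : Type*) [Fintype α] [DecidableEq α] : Type _ :=
  Σ l : ReducedWord α, (nextLabels l.1).powersetCard 2

theorem hasSum_root {E : Type*} [NormedAddCommGroup E] [CompleteSpace E]
    {F : Finset α → List α → E} {g : List α → ℝ} (hg : Summable fun l : ReducedWord α => g l.1)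
    {N₀ : ℕ}
    (hFg : ∀ l I, Reduced l → N₀ ≤ l.length → I ∈ (nextLabels l).powersetCard 2 → ‖F I l‖ ≤ g l)
    {S : E}
    (hS : Tendsto (fun M => ∑ N ∈ range M, ∑ l ∈ wordsOfLength α N,
      ∑ I ∈ (nextLabels l).powersetCard 2, F I l) atTop (𝓝 S)) :
    HasSum (fun r : Root α => F r.2.1 r.1.1) S := by
  have hmajorant : Summable fun r : Root α => |g r.1.1| := by
    have hprod : Summable fun p : ReducedWord α × Finset α => |g p.1.1| * 1 :=
      Summable.mul_of_nonneg (g := fun _ : Finset α => (1 : ℝ)) hg.abs .of_finite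
        (fun _ => abs_nonneg _) fun _ => zero_le_one
    refine (hprod.comp_injective (i := fun r : Root α => (r.1, r.2.1)) ?_).congr fun r =>
      mul_one _
    intro r r' h
    exact Sigma.subtype_ext (Prod.ext_iff.mp h).1 (Prod.ext_iff.mp h).2
  have hshort : {r : Root α | r.1.1.length < N₀}.Finite :=
    (finite_reducedWord_length_lt N₀).preimage' fun l _ => by
      rw [← Set.range_sigmaMk]
      exact Set.finite_range _
  have hsum : Summable fun r : Root α => F r.2.1 r.1.1 := by
    refine hmajorant.of_norm_bounded_eventually ?_
    filter_upwards [hshort.compl_mem_cofinite] with r hr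
    exact (hFg _ _ r.1.2 (not_lt.mp hr) r.2.2).trans (le_abs_self _)
  have hwords : HasSum (fun l : ReducedWord α => ∑ I ∈ (nextLabels l.1).powersetCard 2, F I l.1)
      (∑' r : Root α, F r.2.1 r.1.1) :=
    hsum.hasSum.sigma fun l => ((nextLabels l.1).powersetCard 2).hasSum fun I => F I l.1
  have hlevels := (hasSum_sum_wordsOfLength
    (f := fun l => ∑ I ∈ (nextLabels l).powersetCard 2, F I l) hwords).tendsto_sum_nat
  exact tendsto_nhds_unique hlevels hS ▸ hsum.hasSum

end Words

section CayleyTree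

variable {n : ℕ}

/-- The element of `Γₙ` spelled by a word; the head of the list is the last letter. -/
def wordVal : List (Fin n) → Gam n
  | [] => 1
  | i :: l => wordVal l * gen i

/-- The vector at the end of the path in the Cayley tree that starts at the vertex `1`, with vector
`a`, and has the word `l` as its sequence of labels. -/
def pathVec (a : Fin n → ℂ) (l : List (Fin n)) : Fin n → ℂ := l.foldr flipAt a

theorem pathVec_cons (a : Fin n → ℂ) (i : Fin n) (l : List (Fin n)) :
    pathVec a (i :: l) = flipAt i (pathVec a l) := rfl

theorem orbitMap_mul_gen (a : Fin n → ℂ) (g : Gam n) (i : Fin n) :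
    orbitMap a (g * gen i) = flipAt i (orbitMap a g) := by
  simp only [orbitMap, mul_inv_rev, gen_inv, map_mul, Equiv.Perm.mul_apply, act_gen]

theorem orbitMap_wordVal (a : Fin n → ℂ) (l : List (Fin n)) :
    orbitMap a (wordVal l) = pathVec a l := by
  induction l with
  | nil => simp [wordVal, orbitMap, pathVec]
  | cons i l ih => rw [wordVal, orbitMap_mul_gen, ih, pathVec_cons]

/-- Right multiplication by the generator `bᵢ`, on reduced words. -/
def toggle (i : Fin n) (l : List (Fin n)) : List (Fin n) :=
  if l.head? = some i then l.tail else i :: l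

theorem toggle_of_mem_nextLabels {i : Fin n} {l : List (Fin n)} (h : i ∈ nextLabels l) :
    toggle i l = i :: l :=
  if_neg (mem_nextLabels.mp h)

theorem toggle_cons_self (i : Fin n) (l : List (Fin n)) : toggle i (i :: l) = l :=
  if_pos rfl

theorem reduced_toggle (i : Fin n) {l : List (Fin n)} (h : Reduced l) : Reduced (toggle i l) := by
  unfold toggle
  split_ifs with hi
  · exact h.tail
  · exact reduced_cons.mpr ⟨mem_nextLabels.mpr hi, h⟩

theorem toggle_toggle (i : Fin n) {l : List (Fin n)} (h : Reduced l) :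
    toggle i (toggle i l) = l := by
  by_cases hi : i ∈ nextLabels l
  · rw [toggle_of_mem_nextLabels hi, toggle_cons_self]
  · obtain _ | ⟨j, l⟩ := l
    · simp [nextLabels_nil] at hi
    · obtain rfl : i = j := by simpa [nextLabels_cons] using hi
      rw [toggle_cons_self, toggle_of_mem_nextLabels (reduced_cons.mp h).1]

theorem wordVal_toggle (i : Fin n) (l : List (Fin n)) :
    wordVal (toggle i l) = wordVal l * gen i := by
  unfold toggle
  split_ifs with hi
  · obtain ⟨l, rfl⟩ : ∃ l', l = i :: l' := ⟨_, (List.cons_head?_tail hi).symm⟩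
    simp [wordVal, mul_assoc, gen_mul_self]
  · rfl

/-- `toggle i` as a permutation of the reduced words. -/
def togglePerm (i : Fin n) : Equiv.Perm (ReducedWord (Fin n)) where
  toFun l := ⟨toggle i l.1, reduced_toggle i l.2⟩
  invFun l := ⟨toggle i l.1, reduced_toggle i l.2⟩
  left_inv l := Subtype.ext (toggle_toggle i l.2)
  right_inv l := Subtype.ext (toggle_toggle i l.2)

/-- The action of `Γₙ` on the reduced words (van der Waerden's trick). -/
def wordAct (n : ℕ) : Gam n →* Equiv.Perm (ReducedWord (Fin n)) :=
  PresentedGroup.toGroup (f := togglePerm) (by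
    rintro _ ⟨i, rfl⟩
    rw [map_pow, FreeGroup.lift_apply_of, pow_two]
    ext1 l
    exact Subtype.ext (toggle_toggle i l.2))

theorem wordAct_gen (i : Fin n) : wordAct n (gen i) = togglePerm i := by
  simp only [wordAct, gen, PresentedGroup.toGroup.of]

/-- The reduced word that spells an element of `Γₙ`. -/
def normalForm (g : Gam n) : ReducedWord (Fin n) := wordAct n g⁻¹ ⟨[], List.IsChain.nil⟩

theorem normalForm_mul_gen (g : Gam n) (i : Fin n) :
    (normalForm (g * gen i)).1 = toggle i (normalForm g).1 := by
  simp only [normalForm, mul_inv_rev, gen_inv, map_mul, Equiv.Perm.mul_apply, wordAct_gen]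
  rfl

theorem normalForm_wordVal {l : List (Fin n)} (h : Reduced l) : (normalForm (wordVal l)).1 = l := by
  induction l with
  | nil => simp [normalForm, wordVal]
  | cons i l ih =>
    obtain ⟨hi, hl⟩ := reduced_cons.mp h
    rw [wordVal, normalForm_mul_gen, ih hl, toggle_of_mem_nextLabels hi]

theorem exists_wordVal_eq (g : Gam n) : ∃ l, Reduced l ∧ wordVal l = g := by
  have hg : g ∈ Subgroup.closure (Set.range (gen (n := n))) := by
    rw [show gen (n := n) = PresentedGroup.of from rfl, PresentedGroup.closure_range_of]
    trivial
  induction hg using Subgroup.closure_induction_right with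
  | one => exact ⟨[], List.IsChain.nil, rfl⟩
  | mul_right x _ y hy ih =>
    obtain ⟨i, rfl⟩ := hy
    obtain ⟨l, hl, rfl⟩ := ih
    exact ⟨toggle i l, reduced_toggle i hl, wordVal_toggle i l⟩
  | mul_inv_cancel x _ y hy ih =>
    obtain ⟨i, rfl⟩ := hy
    obtain ⟨l, hl, rfl⟩ := ih
    exact ⟨toggle i l, reduced_toggle i hl, by rw [wordVal_toggle, gen_inv]⟩

/-- The alternating geodesic with labels in `I` through the vertex of a word. -/
def geodAt (I : {I : Finset (Fin n) // I.card = 2}) (l : List (Fin n)) : AltGeod n :=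
  ⟨I, (colorGraph I.1).connectedComponentMk (wordVal l)⟩

theorem phi_geodAt (a : Fin n → ℂ) (I : {I : Finset (Fin n) // I.card = 2}) (l : List (Fin n)) :
    phi a (geodAt I l) = ∏ k ∈ I.1ᶜ, pathVec a l k := by
  rw [← orbitMap_wordVal]; rfl

theorem sigma_geodAt (a : Fin n → ℂ) (I : {I : Finset (Fin n) // I.card = 2}) (l : List (Fin n)) :
    sigma a (geodAt I l) = ∑ k ∈ I.1ᶜ, pathVec a l k ^ 2 := by
  rw [← orbitMap_wordVal]; rfl

theorem geodAt_dropWhile (I : {I : Finset (Fin n) // I.card = 2}) (l : List (Fin n)) :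
    geodAt I (l.dropWhile (· ∈ I.1)) = geodAt I l := by
  induction l with
  | nil => rfl
  | cons i l ih =>
    by_cases hi : i ∈ I.1
    · rw [List.dropWhile_cons_of_pos (by simpa using hi), ih]
      exact congrArg (Sigma.mk I) (SimpleGraph.ConnectedComponent.sound
        (SimpleGraph.Adj.reachable ((colorGraph I.1).symm.symm _ _ ⟨i, hi, rfl⟩)))
    · rw [List.dropWhile_cons_of_neg (by simpa using hi)]

theorem dropWhile_toggle (I : Finset (Fin n)) {i : Fin n} (hi : i ∈ I) (l : List (Fin n)) :
    (toggle i l).dropWhile (· ∈ I) = l.dropWhile (· ∈ I) := by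
  unfold toggle
  split_ifs with h
  · obtain ⟨l, rfl⟩ : ∃ l', l = i :: l' := ⟨_, (List.cons_head?_tail h).symm⟩
    simp [hi]
  · simp [hi]

theorem dropWhile_normalForm_eq_of_walk {I : Finset (Fin n)} {g h : Gam n}
    (p : (colorGraph I).Walk g h) :
    (normalForm g).1.dropWhile (· ∈ I) = (normalForm h).1.dropWhile (· ∈ I) := by
  induction p with
  | nil => rfl
  | cons hadj _ ih =>
    obtain ⟨i, hi, rfl⟩ := hadj
    rw [← ih, normalForm_mul_gen, dropWhile_toggle _ hi]

theorem dropWhile_eq_self_of_subset_nextLabels {I : Finset (Fin n)} {l : List (Fin n)}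
    (h : I ⊆ nextLabels l) : l.dropWhile (· ∈ I) = l := by
  obtain _ | ⟨j, l⟩ := l
  · rfl
  · refine List.dropWhile_cons_of_neg ?_
    rw [nextLabels_cons] at h
    simpa using fun hj => notMem_erase j univ (h hj)

theorem subset_nextLabels_dropWhile (I : Finset (Fin n)) (l : List (Fin n)) :
    I ⊆ nextLabels (l.dropWhile (· ∈ I)) := by
  intro i hi
  rw [mem_nextLabels, Option.mem_def]
  intro hhead
  have := List.head?_dropWhile_not (fun x => decide (x ∈ I)) l
  rw [hhead] at this
  simp [hi] at this

/-- The alternating geodesic with labels `I` through the vertex of the word `l`, where `I` consists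
of two labels that differ from the last letter of `l`. That vertex is the vertex of the geodesic
closest to the vertex `1`. -/
def rootGeod (r : Root (Fin n)) : AltGeod n :=
  geodAt ⟨r.2.1, (mem_powersetCard.mp r.2.2).2⟩ r.1.1

/-- The root of the alternating geodesic with labels in `I` through the vertex of a reduced word. -/
def rootOf (p : {I : Finset (Fin n) // I.card = 2} × ReducedWord (Fin n)) : Root (Fin n) :=
  ⟨⟨p.2.1.dropWhile (· ∈ p.1.1), p.2.2.suffix (List.dropWhile_suffix _)⟩, p.1.1,
    mem_powersetCard.mpr ⟨subset_nextLabels_dropWhile _ _, p.1.2⟩⟩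

theorem rootGeod_rootOf (p : {I : Finset (Fin n) // I.card = 2} × ReducedWord (Fin n)) :
    rootGeod (rootOf p) = geodAt p.1 p.2.1 :=
  geodAt_dropWhile p.1 p.2.1

theorem rootGeod_bijective : Function.Bijective (rootGeod (n := n)) := by
  constructor
  · rintro ⟨⟨l, hl⟩, I, hI⟩ ⟨⟨l', hl'⟩, I', hI'⟩ h
    obtain rfl : I = I' := congrArg (fun γ : AltGeod n => γ.1.1) h
    obtain ⟨p⟩ := SimpleGraph.ConnectedComponent.exact (eq_of_heq (Sigma.mk.inj_iff.mp h).2)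
    have hdrop := dropWhile_normalForm_eq_of_walk p
    obtain rfl : l = l' := by
      rwa [normalForm_wordVal hl, normalForm_wordVal hl',
        dropWhile_eq_self_of_subset_nextLabels (mem_powersetCard.mp hI).1,
        dropWhile_eq_self_of_subset_nextLabels (mem_powersetCard.mp hI').1] at hdrop
    rfl
  · rintro ⟨I, c⟩
    induction c using SimpleGraph.ConnectedComponent.ind with
    | h g =>
      obtain ⟨l, hl, rfl⟩ := exists_wordVal_eq g
      exact ⟨rootOf (I, ⟨l, hl⟩), rootGeod_rootOf _⟩

/-- Alternating geodesics correspond to their roots. -/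
noncomputable def rootEquiv (n : ℕ) : Root (Fin n) ≃ AltGeod n :=
  Equiv.ofBijective _ rootGeod_bijective

end CayleyTree

section BigRoot

/-- The real segment `[-2, 2]` in the complex plane. -/
abbrev realSegment : Set ℂ := Complex.ofReal '' Set.Icc (-2) 2

/-- The solution `b` of `b + b⁻¹ = φ` with `1 < |b|`, for `φ ∉ [-2, 2]`. -/
noncomputable def bigRoot (φ : ℂ) : ℂ := φ * (1 + csqrt (1 - 4 / φ ^ 2)) / 2

theorem ne_zero_of_notMem_realSegment {φ : ℂ} (h : φ ∉ realSegment) : φ ≠ 0 := by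
  rintro rfl
  exact h ⟨0, by norm_num, by simp⟩

theorem bigRoot_inv {φ : ℂ} (h : φ ≠ 0) :
    (bigRoot φ)⁻¹ = φ * (1 - csqrt (1 - 4 / φ ^ 2)) / 2 := by
  refine inv_eq_of_mul_eq_one_right ?_
  calc bigRoot φ * (φ * (1 - csqrt (1 - 4 / φ ^ 2)) / 2)
      = φ ^ 2 * (1 - csqrt (1 - 4 / φ ^ 2) ^ 2) / 4 := by unfold bigRoot; ring
    _ = 1 := by rw [csqrt_sq]; field_simp; ring

theorem bigRoot_add_inv {φ : ℂ} (h : φ ≠ 0) : bigRoot φ + (bigRoot φ)⁻¹ = φ := by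
  rw [bigRoot_inv h, bigRoot]; ring

theorem bigRoot_ne_zero {φ : ℂ} (h : φ ≠ 0) : bigRoot φ ≠ 0 := fun hb => by
  simpa [hb, h.symm] using bigRoot_add_inv h

/-- If `‖b‖ = 1` then `b⁻¹` is the conjugate of `b`, and `φ = 2 Re b` is in the segment. -/
theorem one_lt_norm_bigRoot {φ : ℂ} (h : φ ∉ realSegment) : 1 < ‖bigRoot φ‖ := by
  have hφ := ne_zero_of_notMem_realSegment h
  have hle : ‖(bigRoot φ)⁻¹‖ ≤ ‖bigRoot φ‖ := by
    have hs := csqrt_re_nonneg (1 - 4 / φ ^ 2)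
    rw [bigRoot_inv hφ, bigRoot, norm_div, norm_div, norm_mul, norm_mul]
    set s := csqrt (1 - 4 / φ ^ 2)
    have : ‖1 - s‖ ≤ ‖1 + s‖ := by
      rw [← sq_le_sq₀ (norm_nonneg _) (norm_nonneg _), ← Complex.normSq_eq_norm_sq,
        ← Complex.normSq_eq_norm_sq, Complex.normSq_apply, Complex.normSq_apply]
      simp only [Complex.sub_re, Complex.one_re, Complex.sub_im, Complex.one_im, Complex.add_re,
        Complex.add_im]
      linarith
    gcongr
  have hb : 0 < ‖bigRoot φ‖ := norm_pos_iff.mpr (bigRoot_ne_zero hφ)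
  have hone : 1 ≤ ‖bigRoot φ‖ := by
    by_contra! hlt
    rw [norm_inv] at hle
    linarith [(one_lt_inv₀ hb).mpr hlt]
  refine hone.lt_of_ne fun heq => h ⟨2 * (bigRoot φ).re, ?_, ?_⟩
  · have := abs_le.mp (heq ▸ Complex.abs_re_le_norm (bigRoot φ))
    exact ⟨by linarith, by linarith⟩
  · rw [← Complex.add_conj, ← Complex.inv_eq_conj heq.symm, bigRoot_add_inv hφ]

theorem csqrt_eq_bigRoot {φ : ℂ} (h : φ ≠ 0) :
    csqrt (1 - 4 / φ ^ 2) = (bigRoot φ - (bigRoot φ)⁻¹) / φ := by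
  rw [bigRoot_inv h, bigRoot]; field_simp; ring

theorem hfun_eq_bigRoot {φ : ℂ} (h : φ ≠ 0) :
    hfun φ = (bigRoot φ)⁻¹ / φ + (bigRoot φ)⁻¹ / φ := by
  rw [bigRoot_inv h, hfun]; field_simp; ring

theorem norm_bigRoot_inv_le {φ : ℂ} (h : φ ∉ realSegment) : ‖(bigRoot φ)⁻¹‖ ≤ 2 / ‖φ‖ := by
  have hφ := ne_zero_of_notMem_realSegment h
  have hb := one_lt_norm_bigRoot h
  have hle : ‖φ‖ ≤ 2 * ‖bigRoot φ‖ :=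
    calc ‖φ‖ = ‖bigRoot φ + (bigRoot φ)⁻¹‖ := by rw [bigRoot_add_inv hφ]
      _ ≤ ‖bigRoot φ‖ + ‖bigRoot φ‖⁻¹ := norm_inv (bigRoot φ) ▸ norm_add_le _ _
      _ ≤ 2 * ‖bigRoot φ‖ := by linarith [inv_le_one_of_one_le₀ hb.le]
  rw [norm_inv, le_div_iff₀ (norm_pos_iff.mpr hφ), inv_mul_le_iff₀ (by linarith)]
  linarith

theorem norm_hfun_le {φ : ℂ} (h : φ ∉ realSegment) : ‖hfun φ‖ ≤ 4 / ‖φ‖ ^ 2 := by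
  rw [hfun_eq_bigRoot (ne_zero_of_notMem_realSegment h)]
  calc ‖(bigRoot φ)⁻¹ / φ + (bigRoot φ)⁻¹ / φ‖
      ≤ ‖(bigRoot φ)⁻¹‖ / ‖φ‖ + ‖(bigRoot φ)⁻¹‖ / ‖φ‖ := by
        rw [← norm_div]; exact norm_add_le _ _
    _ ≤ 2 / ‖φ‖ / ‖φ‖ + 2 / ‖φ‖ / ‖φ‖ := by gcongr <;> exact norm_bigRoot_inv_le h
    _ = 4 / ‖φ‖ ^ 2 := by ring

end BigRoot

section Flips

variable {n : ℕ} (x : Fin n → ℂ) {i j k : Fin n}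

theorem exists_third (hn : 3 ≤ n) (i j : Fin n) : ∃ k : Fin n, k ≠ i ∧ k ≠ j := by
  obtain ⟨k, hk⟩ := Finset.exists_mem_notMem_of_card_lt_card
    (s := {i, j}) (t := univ) (card_le_two.trans_lt (by simpa using Nat.lt_of_succ_le hn))
  exact ⟨k, by simpa using hk.2⟩

/-- The product of the coordinates other than the `i`-th and the `j`-th; the value of `φ` at an
alternating `{i, j}`-geodesic with the vector `x` at one of its vertices. -/
def coProd (x : Fin n → ℂ) (i j : Fin n) : ℂ := ∏ k ∈ {i, j}ᶜ, x k

/-- The sum of the squares of the coordinates other than the `i`-th and the `j`-th; the value of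
`σ` at an alternating `{i, j}`-geodesic with the vector `x` at one of its vertices. -/
def coSum (x : Fin n → ℂ) (i j : Fin n) : ℂ := ∑ k ∈ {i, j}ᶜ, x k ^ 2

theorem coProd_comm (i j : Fin n) : coProd x i j = coProd x j i := by
  rw [coProd, coProd, pair_comm]

theorem flipAt_ne (h : k ≠ i) : flipAt i x k = x k := by
  simp [flipAt, h]

theorem flipAt_of_mem_compl (hk : k ∈ ({i, j} : Finset (Fin n))ᶜ) : flipAt i x k = x k :=
  flipAt_ne x fun h => by simp [h] at hk

theorem coProd_flipAt (i j : Fin n) : coProd (flipAt i x) i j = coProd x i j :=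
  prod_congr rfl fun _ hk => flipAt_of_mem_compl x hk

theorem coSum_flipAt (i j : Fin n) : coSum (flipAt i x) i j = coSum x i j :=
  sum_congr rfl fun _ hk => by rw [flipAt_of_mem_compl x hk]

theorem prod_erase_eq (h : i ≠ j) : ∏ k ∈ univ.erase i, x k = coProd x i j * x j := by
  have : univ.erase i = insert j ({i, j} : Finset (Fin n))ᶜ := by
    ext k; simp; grind
  rw [this, prod_insert (by simp), coProd, mul_comm]

theorem flipAt_self_eq_prod_erase (i : Fin n) :
    flipAt i x i = ∏ k ∈ univ.erase i, x k - x i := by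
  simp [flipAt]

theorem flipAt_self (h : i ≠ j) : flipAt i x i = coProd x i j * x j - x i := by
  rw [flipAt_self_eq_prod_erase, prod_erase_eq x h]

theorem prod_eq_coProd (h : i ≠ j) : ∏ k, x k = coProd x i j * x i * x j := by
  rw [← mul_prod_erase _ _ (mem_univ i), prod_erase_eq x h]; ring

theorem coProd_mul_eq (hij : i ≠ j) (hik : i ≠ k) : coProd x i j * x j = coProd x i k * x k := by
  rw [← prod_erase_eq x hij, ← prod_erase_eq x hik]

theorem coSum_sub_hurwitzPoly (h : i ≠ j) :
    coSum x i j - hurwitzPoly x = coProd x i j * x i * x j - (x i ^ 2 + x j ^ 2) := by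
  rw [hurwitzPoly, ← sum_compl_add_sum {i, j}, sum_pair h, prod_eq_coProd x h, coSum]; ring

theorem hurwitzPoly_flipAt (hn : 3 ≤ n) (i : Fin n) : hurwitzPoly (flipAt i x) = hurwitzPoly x := by
  obtain ⟨j, hj, -⟩ := exists_third hn i i
  have h := coSum_sub_hurwitzPoly x hj.symm
  have h' := coSum_sub_hurwitzPoly (flipAt i x) hj.symm
  rw [coSum_flipAt, coProd_flipAt, flipAt_self x hj.symm, flipAt_ne x hj] at h'
  linear_combination h - h'

theorem hurwitzPoly_pathVec (hn : 3 ≤ n) (a : Fin n → ℂ) (l : List (Fin n)) :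
    hurwitzPoly (pathVec a l) = hurwitzPoly a := by
  induction l with
  | nil => rfl
  | cons i l ih => rw [pathVec_cons, hurwitzPoly_flipAt _ hn, ih]

theorem ne_zero_of_coProd_ne_zero (hn : 3 ≤ n) {x : Fin n → ℂ}
    (h : ∀ i j, i ≠ j → coProd x i j ≠ 0) (k : Fin n) : x k ≠ 0 := by
  obtain ⟨i, hi, -⟩ := exists_third hn k k
  obtain ⟨j, hj, hji⟩ := exists_third hn k i
  exact prod_ne_zero_iff.mp (h i j hji.symm) k (by simp [hi.symm, hj.symm])

end Flips

section Identities

variable {n : ℕ} (x : Fin n → ℂ) {i j : Fin n}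

/-- The coefficient of the growing part of the solution of `uₖ₊₂ = φ uₖ₊₁ - uₖ` that describes the
coordinates along the alternating path starting at `x` with labels `i, j, i, …`. -/
noncomputable def growthCoeff (x : Fin n → ℂ) (i j : Fin n) : ℂ :=
  bigRoot (coProd x i j) * x j - x i

/-- Half of the value of `hfun` at the alternating `{i, j}`-geodesic through `x`. -/
noncomputable def halfTerm (x : Fin n → ℂ) (i j : Fin n) : ℂ :=
  (bigRoot (coProd x i j))⁻¹ / coProd x i j

/-- The sum of the inverses of the products of all coordinates, over the vertices after `x` on the
alternating path that starts at `x` and has the labels `i, j, i, …`; see `hasSum_inv_prod`. -/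
noncomputable def tailSum (x : Fin n → ℂ) (i j : Fin n) : ℂ :=
  (coProd x i j * x j * growthCoeff x i j)⁻¹

theorem halfTerm_add_halfTerm (h : coProd x i j ≠ 0) :
    halfTerm x i j + halfTerm x j i = hfun (coProd x i j) := by
  rw [hfun_eq_bigRoot h, halfTerm, halfTerm, coProd_comm x j i]

theorem halfTerm_flipAt (i j : Fin n) : halfTerm (flipAt i x) j i = halfTerm x i j := by
  rw [halfTerm, halfTerm, coProd_comm _ j i, coProd_flipAt]

theorem coSum_sub_hurwitzPoly_eq (hij : i ≠ j) (h : coProd x i j ≠ 0) :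
    coSum x i j - hurwitzPoly x =
      growthCoeff x i j * growthCoeff x j i / bigRoot (coProd x i j) := by
  have hb := bigRoot_ne_zero h
  have hφ := bigRoot_add_inv h
  rw [coSum_sub_hurwitzPoly x hij, growthCoeff, growthCoeff, coProd_comm x j i]
  set b := bigRoot (coProd x i j)
  rw [← hφ]
  field_simp
  ring

theorem sq_mul_sub_halfTerm (hij : i ≠ j) (h : coProd x i j ≠ 0) (hj : x j ≠ 0)
    (hd : growthCoeff x i j ≠ 0) :
    x i ^ 2 * (∏ k, x k)⁻¹ - halfTerm x i j = (coSum x i j - hurwitzPoly x) * tailSum x i j := by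
  have hb := bigRoot_ne_zero h
  have hdd : growthCoeff x j i = bigRoot (coProd x i j) * x i - x j := by
    rw [growthCoeff, coProd_comm]
  rw [coSum_sub_hurwitzPoly_eq x hij h, halfTerm, tailSum, prod_eq_coProd x hij, hdd]
  field_simp

theorem csqrt_div_eq_add_tailSum (hij : i ≠ j) (h : coProd x i j ≠ 0) (hi : x i ≠ 0)
    (hj : x j ≠ 0) (hd : growthCoeff x i j ≠ 0) (hd' : growthCoeff x j i ≠ 0) :
    csqrt (1 - 4 / coProd x i j ^ 2) / (coSum x i j - hurwitzPoly x) =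
      (∏ k, x k)⁻¹ + tailSum x i j + tailSum x j i := by
  have hb := bigRoot_ne_zero h
  have hdd : growthCoeff x j i = bigRoot (coProd x i j) * x i - x j := by
    rw [growthCoeff, coProd_comm]
  have hquadratic : growthCoeff x i j * growthCoeff x j i + x i * growthCoeff x j i
      + x j * growthCoeff x i j = (bigRoot (coProd x i j) ^ 2 - 1) * (x i * x j) := by
    rw [hdd, growthCoeff]; ring
  rw [csqrt_eq_bigRoot h, coSum_sub_hurwitzPoly_eq x hij h, tailSum, tailSum, prod_eq_coProd x hij,
    coProd_comm x j i]
  field_simp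
  linear_combination -hquadratic

end Identities

section AlternatingPaths

variable {n : ℕ} {c : ℕ → Fin n} {X : ℕ → Fin n → ℂ}

/-- A sequence of labels that alternates between two labels. -/
structure IsAlternating (c : ℕ → Fin n) : Prop where
  periodic : ∀ k, c (k + 2) = c k
  ne_succ : ∀ k, c k ≠ c (k + 1)

/-- The vectors at the vertices of a path in the Cayley tree whose labels alternate. -/
structure IsAlternatingPath (c : ℕ → Fin n) (X : ℕ → Fin n → ℂ) : Prop extends
    IsAlternating c where
  step : ∀ k, X (k + 1) = flipAt (c k) (X k)

theorem exists_isAlternating {i j : Fin n} (hij : i ≠ j) :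
    ∃ c : ℕ → Fin n, IsAlternating c ∧ c 0 = i ∧ c 1 = j :=
  ⟨fun k => if Even k then i else j,
    ⟨fun k => by simp [Nat.even_add], fun k => by by_cases hk : Even k <;>
      simp [hk, Nat.even_add_one, hij, hij.symm]⟩, by simp, by simp⟩

theorem IsAlternating.eq_or_eq (h : IsAlternating c) (k : ℕ) :
    (c k = c 0 ∧ c (k + 1) = c 1) ∨ (c k = c 1 ∧ c (k + 1) = c 0) := by
  induction k with
  | zero => exact .inl ⟨rfl, rfl⟩
  | succ k ih =>
    rcases ih with ⟨h₀, h₁⟩ | ⟨h₀, h₁⟩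
    · exact .inr ⟨h₁, by rw [h.periodic, h₀]⟩
    · exact .inl ⟨h₁, by rw [h.periodic, h₀]⟩

namespace IsAlternatingPath

variable (h : IsAlternatingPath c X)
include h

theorem eq_of_ne {m : Fin n} (h₀ : m ≠ c 0) (h₁ : m ≠ c 1) (k : ℕ) : X k m = X 0 m := by
  induction k with
  | zero => rfl
  | succ k ih =>
    rw [h.step, flipAt_ne, ih]
    rcases h.eq_or_eq k with ⟨hk, -⟩ | ⟨hk, -⟩ <;> rwa [hk]

theorem coProd_eq (k : ℕ) : coProd (X k) (c k) (c (k + 1)) = coProd (X 0) (c 0) (c 1) := by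
  induction k with
  | zero => rfl
  | succ k ih => rw [h.periodic, coProd_comm, h.step, coProd_flipAt, ih]

theorem apply_succ (k : ℕ) : X (k + 1) (c (k + 1)) = X k (c (k + 1)) := by
  rw [h.step, flipAt_ne _ (h.ne_succ k).symm]

theorem recurrence (k : ℕ) : X (k + 2) (c (k + 2)) =
    coProd (X 0) (c 0) (c 1) * X (k + 1) (c (k + 1)) - X k (c k) := by
  rw [h.apply_succ, h.periodic, h.apply_succ, h.step, flipAt_self _ (h.ne_succ k), h.coProd_eq]

theorem prod_eq (k : ℕ) : ∏ m, X (k + 1) m =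
    coProd (X 0) (c 0) (c 1) * (X (k + 1) (c (k + 1)) * X (k + 2) (c (k + 2))) := by
  rw [prod_eq_coProd _ (h.ne_succ (k + 1)), h.coProd_eq, h.apply_succ (k + 1), mul_assoc]

theorem growthCoeff_eq : growthCoeff (X 0) (c 0) (c 1) =
    bigRoot (coProd (X 0) (c 0) (c 1)) * X 1 (c 1) - X 0 (c 0) := by
  rw [growthCoeff, h.apply_succ 0]

variable (hφ : coProd (X 0) (c 0) (c 1) ∉ realSegment)
include hφ

theorem recurrence_bigRoot (k : ℕ) : X (k + 2) (c (k + 2)) =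
    (bigRoot (coProd (X 0) (c 0) (c 1)) + (bigRoot (coProd (X 0) (c 0) (c 1)))⁻¹) *
      X (k + 1) (c (k + 1)) - X k (c k) := by
  rw [bigRoot_add_inv (ne_zero_of_notMem_realSegment hφ), h.recurrence]

theorem tendsto_norm_atTop (hd : growthCoeff (X 0) (c 0) (c 1) ≠ 0) :
    Tendsto (fun k => ‖X k (c k)‖) atTop atTop :=
  tendsto_norm_recurrence_atTop (u := fun k => X k (c k)) (one_lt_norm_bigRoot hφ)
    (h.recurrence_bigRoot hφ) (sub_ne_zero.mp (h.growthCoeff_eq ▸ hd))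

theorem tendsto_zero (hd : growthCoeff (X 0) (c 0) (c 1) = 0) :
    Tendsto (fun k => X k (c k)) atTop (𝓝 0) :=
  tendsto_recurrence_zero (u := fun k => X k (c k)) (one_lt_norm_bigRoot hφ)
    (h.recurrence_bigRoot hφ) (sub_eq_zero.mp (h.growthCoeff_eq ▸ hd))

theorem eventually_mul_norm_le (hd : growthCoeff (X 0) (c 0) (c 1) ≠ 0) {ρ : ℝ}
    (hρ : ρ < ‖bigRoot (coProd (X 0) (c 0) (c 1))‖) :
    ∀ᶠ k in atTop, ρ * ‖X k (c k)‖ ≤ ‖X (k + 1) (c (k + 1))‖ :=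
  eventually_mul_norm_recurrence_le (u := fun k => X k (c k)) (one_lt_norm_bigRoot hφ)
    (h.recurrence_bigRoot hφ) (sub_ne_zero.mp (h.growthCoeff_eq ▸ hd)) hρ

theorem hasSum_inv_prod (hd : growthCoeff (X 0) (c 0) (c 1) ≠ 0) (hX : ∀ k m, X k m ≠ 0) :
    HasSum (fun k => (∏ m, X (k + 1) m)⁻¹) (tailSum (X 0) (c 0) (c 1)) := by
  have hsum := (hasSum_inv_mul_recurrence (u := fun k => X k (c k)) (one_lt_norm_bigRoot hφ)
    (h.recurrence_bigRoot hφ) (sub_ne_zero.mp (h.growthCoeff_eq ▸ hd))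
    fun k => hX _ _).mul_left (coProd (X 0) (c 0) (c 1))⁻¹
  rw [← mul_inv, ← mul_assoc, ← h.growthCoeff_eq, h.apply_succ 0] at hsum
  simpa only [tailSum, h.prod_eq, mul_inv (coProd _ _ _)] using hsum

end IsAlternatingPath

end AlternatingPaths

section ExtendBy

variable {n : ℕ}

/-- The word `l` extended by the first `k` labels of the sequence `c`. -/
def extendBy {α : Type*} (c : ℕ → α) (l : List α) : ℕ → List α
  | 0 => l
  | k + 1 => c k :: extendBy c l k

theorem length_extendBy {α : Type*} (c : ℕ → α) (l : List α) (k : ℕ) :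
    (extendBy c l k).length = l.length + k := by
  induction k with
  | zero => rfl
  | succ k ih => rw [extendBy, List.length_cons, ih, add_assoc]

theorem extendBy_add {α : Type*} (c : ℕ → α) (l : List α) (m k : ℕ) :
    extendBy c l (m + k) = extendBy (fun r => c (m + r)) (extendBy c l m) k := by
  induction k with
  | zero => rfl
  | succ k ih => rw [← add_assoc, extendBy, ih, extendBy]

theorem reduced_extendBy {α : Type*} {c : ℕ → α} {l : List α} (hc : ∀ k, c k ≠ c (k + 1))
    (h₀ : Reduced (c 0 :: l)) (k : ℕ) : Reduced (extendBy c l k) := by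
  induction k with
  | zero => exact h₀.tail
  | succ k ih =>
    cases k with
    | zero => exact h₀
    | succ k => exact List.isChain_cons_cons.mpr ⟨(hc k).symm, ih⟩

theorem mem_of_length_dropWhile_extendBy_le {α : Type*} {p : α → Bool} {c : ℕ → α} {k m : ℕ}
    (hk : k < m) (h : ((extendBy c [] m).dropWhile p).length ≤ k) : p (c k) := by
  induction m with
  | zero => exact absurd hk (Nat.not_lt_zero k)
  | succ m ih =>
    rw [extendBy] at h
    by_cases hm : p (c m)
    · rw [List.dropWhile_cons_of_pos hm] at h
      rcases Nat.lt_succ_iff_lt_or_eq.mp hk with hlt | rfl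
      · exact ih hlt h
      · exact hm
    · rw [List.dropWhile_cons_of_neg hm, List.length_cons, length_extendBy] at h
      simp at h
      omega

theorem IsAlternating.isAlternatingPath_extendBy {c : ℕ → Fin n} (hc : IsAlternating c)
    (a : Fin n → ℂ) (l : List (Fin n)) :
    IsAlternatingPath c fun k => pathVec a (extendBy c l k) :=
  ⟨hc, fun _ => rfl⟩

end ExtendBy

section Domain

variable {n : ℕ} {a : Fin n → ℂ} {i j : Fin n}

theorem coProd_pathVec_eq_phi (a : Fin n → ℂ) (l : List (Fin n)) (hij : i ≠ j) :
    coProd (pathVec a l) i j = phi a (geodAt ⟨{i, j}, card_pair hij⟩ l) := by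
  rw [phi_geodAt, coProd]

theorem coProd_notMem_realSegment (ha : a ∈ domainD n) (l : List (Fin n)) (hij : i ≠ j) :
    coProd (pathVec a l) i j ∉ realSegment := by
  rw [coProd_pathVec_eq_phi a l hij]
  exact ha.1 _

theorem coProd_ne_zero (ha : a ∈ domainD n) (l : List (Fin n)) (hij : i ≠ j) :
    coProd (pathVec a l) i j ≠ 0 :=
  ne_zero_of_notMem_realSegment (coProd_notMem_realSegment ha l hij)

theorem pathVec_ne_zero (hn : 3 ≤ n) (ha : a ∈ domainD n) (l : List (Fin n)) (k : Fin n) :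
    pathVec a l k ≠ 0 :=
  ne_zero_of_coProd_ne_zero hn (fun _ _ => coProd_ne_zero ha l) k

theorem exists_pos_le_norm_coProd (ha : a ∈ domainD n) :
    ∃ ε : ℝ, 0 < ε ∧ ∀ l i j, i ≠ j → ε ≤ ‖coProd (pathVec a l) i j‖ := by
  obtain ⟨hseg, K, hK, hfin⟩ := ha
  obtain ⟨ε, hε, hεK, hle⟩ := exists_pos_le_of_finite hfin (f := fun γ => ‖phi a γ‖)
    (fun γ _ => norm_pos_iff.mpr (ne_zero_of_notMem_realSegment (hseg γ)))
    (two_pos.trans hK)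
  refine ⟨ε, hε, fun l i j hij => ?_⟩
  rw [coProd_pathVec_eq_phi a l hij]
  exact (le_total K _).elim hεK.trans (hle _)

/-- Otherwise the coordinates along the alternating path tend to `0` and so do, by `coProd_mul_eq`,
the values of `φ` at the geodesics that branch off with some third label. -/
theorem growthCoeff_ne_zero (hn : 3 ≤ n) (ha : a ∈ domainD n) (l : List (Fin n)) (hij : i ≠ j) :
    growthCoeff (pathVec a l) i j ≠ 0 := by
  intro hzero
  obtain ⟨c, hc, rfl, rfl⟩ := exists_isAlternating hij
  have hpath := hc.isAlternatingPath_extendBy a l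
  have hlim := hpath.tendsto_zero (coProd_notMem_realSegment ha l hij) hzero
  obtain ⟨m, hm₀, hm₁⟩ := exists_third hn (c 0) (c 1)
  obtain ⟨ε, hε, hlow⟩ := exists_pos_le_norm_coProd ha
  have hbound (k : ℕ) : ε * ‖pathVec a l m‖ ≤
      ‖coProd (pathVec a l) (c 0) (c 1) * pathVec a (extendBy c l (k + 1)) (c (k + 1))‖ := by
    have hmk : c k ≠ m := by rcases hc.eq_or_eq k with h | h <;> simp [h.1, hm₀.symm, hm₁.symm]
    have hmul := coProd_mul_eq (pathVec a (extendBy c l k)) (hc.ne_succ k) hmk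
    rw [hpath.coProd_eq k, ← hpath.apply_succ k, hpath.eq_of_ne hm₀ hm₁ k] at hmul
    rw [show coProd (pathVec a l) (c 0) (c 1) * _ = _ from hmul, norm_mul]
    exact mul_le_mul_of_nonneg_right (hlow _ _ _ hmk) (norm_nonneg _)
  have hle := ge_of_tendsto' ((hlim.comp (tendsto_add_atTop_nat 1)).const_mul _).norm hbound
  rw [mul_zero, norm_zero] at hle
  exact hle.not_gt (mul_pos hε (norm_pos_iff.mpr (pathVec_ne_zero hn ha l m)))

theorem coSum_sub_ne_zero (hn : 3 ≤ n) (ha : a ∈ domainD n) (l : List (Fin n)) (hij : i ≠ j) :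
    coSum (pathVec a l) i j - hurwitzPoly (pathVec a l) ≠ 0 := by
  rw [coSum_sub_hurwitzPoly_eq _ hij (coProd_ne_zero ha l hij)]
  exact div_ne_zero (mul_ne_zero (growthCoeff_ne_zero hn ha l hij)
    (growthCoeff_ne_zero hn ha l hij.symm)) (bigRoot_ne_zero (coProd_ne_zero ha l hij))

theorem exists_length_dropWhile_lt (ha : a ∈ domainD n) :
    ∃ K : ℝ, 2 < K ∧ ∃ N : ℕ, ∀ l, Reduced l → ∀ i j, i ≠ j → ‖coProd (pathVec a l) i j‖ ≤ K →
      (l.dropWhile (· ∈ ({i, j} : Finset (Fin n)))).length < N := by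
  obtain ⟨-, K, hK, hfin⟩ := ha
  obtain ⟨B, hB⟩ := (hfin.image fun γ => ((rootEquiv n).symm γ).1.1.length).bddAbove
  refine ⟨K, hK, B + 1, fun l hl i j hij hle => Nat.lt_succ_of_le ?_⟩
  let p : {I : Finset (Fin n) // I.card = 2} × ReducedWord (Fin n) :=
    (⟨{i, j}, card_pair hij⟩, ⟨l, hl⟩)
  rw [coProd_pathVec_eq_phi a l hij, ← rootGeod_rootOf p] at hle
  have hroot : ((rootEquiv n).symm (rootEquiv n (rootOf p))).1.1.length ≤ B := hB ⟨_, hle, rfl⟩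
  rwa [Equiv.symm_apply_apply] at hroot

end Domain

section Growth

variable {n : ℕ} {a : Fin n → ℂ} {K : ℝ} {i j : Fin n} {l w : List (Fin n)}

/-- The `j`-th coordinate of `x` dominates the others, and the values of `φ` at the alternating
geodesics through `x` that use the label `j` are large. -/
def Dominant (K : ℝ) (x : Fin n → ℂ) (j : Fin n) : Prop :=
  ∀ i, i ≠ j → K / 2 * ‖x i‖ ≤ ‖x j‖ ∧ K ≤ ‖coProd x j i‖

theorem Dominant.norm_le (hK : 2 ≤ K) {x : Fin n → ℂ} (h : Dominant K x j) (k : Fin n) :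
    ‖x k‖ ≤ ‖x j‖ := by
  rcases eq_or_ne k j with rfl | hk
  · rfl
  · nlinarith [(h k hk).1, norm_nonneg (x k)]

theorem dominant_flipAt (hK : 2 ≤ K) {x : Fin n → ℂ} (hx : ∀ k, x k ≠ 0) (hij : i ≠ j)
    (hmax : ∀ k, ‖x k‖ ≤ ‖x j‖) (hlarge : K ≤ ‖coProd x i j‖) :
    Dominant K (flipAt i x) i := by
  intro k hk
  have hmul : ‖coProd x i k‖ * ‖x k‖ = ‖coProd x i j‖ * ‖x j‖ := by
    rw [← norm_mul, ← norm_mul, coProd_mul_eq x hk.symm hij]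
  have hK_mul : K * ‖x j‖ ≤ ‖coProd x i j‖ * ‖x j‖ := by gcongr
  rw [flipAt_ne x hk, coProd_flipAt]
  constructor
  · calc K / 2 * ‖x k‖ ≤ K / 2 * ‖x j‖ := by gcongr; exact hmax k
      _ ≤ ‖coProd x i j‖ * ‖x j‖ - ‖x i‖ := by nlinarith [hmax i, norm_nonneg (x j)]
      _ ≤ ‖flipAt i x i‖ := by rw [flipAt_self x hij, ← norm_mul]; exact norm_sub_norm_le _ _
  · refine le_of_mul_le_mul_right ?_ (norm_pos_iff.mpr (hx k))
    calc K * ‖x k‖ ≤ K * ‖x j‖ := by gcongr; exact hmax k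
      _ ≤ ‖coProd x i k‖ * ‖x k‖ := hmul ▸ hK_mul

/-- In all sufficiently long reduced extensions of the word `l`, the coordinate of the last letter
dominates the other coordinates by a fixed factor. -/
def EventuallyGrowing (a : Fin n → ℂ) (l : List (Fin n)) : Prop :=
  ∃ ρ : ℝ, 1 < ρ ∧ ∃ N : ℕ, ∀ w j, Reduced (j :: w) → l <:+ w → N ≤ w.length →
    ∀ i, i ≠ j → ρ * ‖pathVec a (j :: w) i‖ ≤ ‖pathVec a (j :: w) j‖

namespace EventuallyGrowing

theorem of_not_reduced (h : ¬ Reduced l) : EventuallyGrowing a l :=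
  ⟨2, one_lt_two, 0, fun _ _ hr hs => absurd (hr.tail.suffix hs) h⟩

theorem of_cons [NeZero n] (h : ∀ i, EventuallyGrowing a (i :: l)) : EventuallyGrowing a l := by
  choose ρ hρ N hN using h
  obtain ⟨i₀, hi₀⟩ := Finite.exists_min ρ
  refine ⟨ρ i₀, hρ i₀, max (l.length + 1) (univ.sup N), fun w j hr hs hl i hi => ?_⟩
  obtain ⟨k, hk⟩ := exists_cons_suffix hs (by omega)
  have hNk : N k ≤ univ.sup N := le_sup (mem_univ k)
  refine le_trans ?_ (hN k w j hr hk (by omega) i hi)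
  gcongr
  exact hi₀ k

end EventuallyGrowing

variable (hn : 3 ≤ n) (ha : a ∈ domainD n)
include hn ha

theorem Dominant.pathVec_cons (hK : 2 ≤ K) (hr : Reduced (i :: w))
    (h : ∃ j ∈ w.head?, Dominant K (pathVec a w) j) : Dominant K (pathVec a (i :: w)) i := by
  obtain ⟨j, hj, hd⟩ := h
  have hij : i ≠ j := fun h => mem_nextLabels.mp (reduced_cons.mp hr).1 (h ▸ hj)
  refine dominant_flipAt hK (pathVec_ne_zero hn ha w) hij (hd.norm_le hK) ?_
  rw [coProd_comm]
  exact (hd i hij).2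

theorem Dominant.eventuallyGrowing (hK : 2 < K) (hd : Dominant K (pathVec a (j :: l)) j) :
    EventuallyGrowing a (j :: l) := by
  have hhead : ∀ w, (j :: l) <:+ w → Reduced w → ∃ i ∈ w.head?, Dominant K (pathVec a w) i :=
    suffix_induction (fun _ => ⟨j, rfl, hd⟩) fun i w _ ih hr =>
      ⟨i, rfl, Dominant.pathVec_cons hn ha hK.le hr (ih hr.tail)⟩
  exact ⟨K / 2, by linarith, 0, fun w k hr hs _ i hi =>
    (Dominant.pathVec_cons hn ha hK.le hr (hhead w hs hr.tail) i hi).1⟩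

theorem eventuallyGrowing_cons_of_norm_le (hK : 2 < K) (hij : i ≠ j)
    (hlarge : K ≤ ‖coProd (pathVec a l) i j‖) (hmax : ∀ k, ‖pathVec a l k‖ ≤ ‖pathVec a l j‖) :
    EventuallyGrowing a (i :: l) :=
  (dominant_flipAt hK.le (pathVec_ne_zero hn ha l) hij hmax hlarge).eventuallyGrowing hn ha hK

omit hn ha in
theorem mul_norm_le_of_norm_flipAt_le {x : Fin n → ℂ} (hij : i ≠ j)
    (hlarge : K ≤ ‖coProd x i j‖) (hle : ‖flipAt i x i‖ ≤ ‖x j‖) : (K - 1) * ‖x j‖ ≤ ‖x i‖ := by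
  have hflip : coProd x i j * x j = flipAt i x i + x i := by rw [flipAt_self x hij]; ring
  have hnorm : K * ‖x j‖ ≤ ‖flipAt i x i‖ + ‖x i‖ :=
    calc K * ‖x j‖ ≤ ‖coProd x i j‖ * ‖x j‖ := by gcongr
      _ ≤ _ := by rw [← norm_mul, hflip]; exact norm_add_le _ _
  linarith

/-- All values of `φ` at the geodesics through the vertices after that of `l` are large. -/
def LargeAfter (a : Fin n → ℂ) (K : ℝ) (l : List (Fin n)) : Prop :=
  ∀ w, Reduced w → l <:+ w → ∀ i j, i ≠ j → K ≤ ‖coProd (pathVec a w) i j‖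

/-- The flips of all coordinates but the largest produce a dominant coordinate; if the flip of the
largest does not, then the maximum of the coordinates drops by the factor `K - 1`. -/
theorem LargeAfter.eventuallyGrowing_of_le_pow (hK : 2 < K) (m : ℕ) {l : List (Fin n)}
    (hlarge : LargeAfter a K l) (hle : ∀ k, ‖pathVec a l k‖ ≤ (K - 1) ^ m) :
    EventuallyGrowing a l := by
  have : NeZero n := ⟨by omega⟩
  induction m generalizing l with
  | zero =>
    refine .of_not_reduced fun hr => ?_
    obtain ⟨k, hk, -⟩ := exists_third hn 0 0
    have hprod : ‖coProd (pathVec a l) k 0‖ ≤ 1 := by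
      rw [coProd, norm_prod]
      exact prod_le_one (fun _ _ => norm_nonneg _) fun r _ => by simpa using hle r
    linarith [hlarge l hr List.suffix_rfl _ _ hk]
  | succ m ih =>
    refine .of_cons fun i => ?_
    by_cases hr : Reduced (i :: l)
    swap
    · exact .of_not_reduced hr
    have hlarge_l := hlarge l hr.tail List.suffix_rfl
    obtain ⟨j, hj⟩ := Finite.exists_max fun k => ‖pathVec a l k‖
    rcases ne_or_eq i j with hij | rfl
    · exact eventuallyGrowing_cons_of_norm_le hn ha hK hij (hlarge_l _ _ hij) hj
    have hlarge' : LargeAfter a K (i :: l) :=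
      fun w hw hs => hlarge w hw ((List.suffix_cons i l).trans hs)
    obtain ⟨j, hj'⟩ := Finite.exists_max fun k => ‖pathVec a (i :: l) k‖
    rcases eq_or_ne j i with rfl | hji
    · refine .of_cons fun i => ?_
      rcases eq_or_ne i j with rfl | hij
      · exact .of_not_reduced (by simp)
      · exact eventuallyGrowing_cons_of_norm_le hn ha hK hij
          (hlarge' _ hr List.suffix_rfl _ _ hij) hj'
    refine ih hlarge' fun k => (hj' k).trans ?_
    have hj_eq : pathVec a (i :: l) j = pathVec a l j := flipAt_ne _ hji
    have hdrop := mul_norm_le_of_norm_flipAt_le hji.symm (hlarge_l _ _ hji.symm)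
      (hj_eq ▸ hj' i)
    rw [hj_eq]
    exact le_of_mul_le_mul_left (hdrop.trans (pow_succ' (K - 1) m ▸ hle i)) (by linarith)

theorem LargeAfter.eventuallyGrowing (hK : 2 < K) (hlarge : LargeAfter a K l) :
    EventuallyGrowing a l := by
  obtain ⟨m, hm⟩ := pow_unbounded_of_one_lt (∑ k, ‖pathVec a l k‖) (show 1 < K - 1 by linarith)
  exact hlarge.eventuallyGrowing_of_le_pow hn ha hK m fun k => le_trans
    (single_le_sum (f := fun k => ‖pathVec a l k‖) (fun _ _ => norm_nonneg _) (mem_univ k)) hm.le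

omit hn ha in
theorem IsAlternatingPath.exists_eventually_mul_norm_le {c : ℕ → Fin n} {X : ℕ → Fin n → ℂ}
    (h : IsAlternatingPath c X) (hφ : coProd (X 0) (c 0) (c 1) ∉ realSegment)
    (hd : growthCoeff (X 0) (c 0) (c 1) ≠ 0) (R : ℝ) :
    ∃ ρ : ℝ, 1 < ρ ∧ ∀ᶠ k in atTop, ρ * ‖X k (c k)‖ ≤ ‖X k (c (k + 1))‖ ∧
      ∀ m, m ≠ c k → m ≠ c (k + 1) → R * ‖X k m‖ ≤ ‖X k (c k)‖ := by
  obtain ⟨ρ, hρ, hρb⟩ := exists_between (one_lt_norm_bigRoot hφ)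
  refine ⟨ρ, hρ, ?_⟩
  have hlarge : ∀ᶠ k in atTop, ∀ m, R * ‖X 0 m‖ ≤ ‖X k (c k)‖ :=
    eventually_all.mpr fun m => (h.tendsto_norm_atTop hφ hd).eventually_ge_atTop _
  filter_upwards [h.eventually_mul_norm_le hφ hd hρb, hlarge] with k hgrow hR
  refine ⟨h.apply_succ k ▸ hgrow, fun m hm hm' => ?_⟩
  rw [h.eq_of_ne _ _ k]
  · exact hR m
  all_goals rcases h.eq_or_eq k with ⟨h₀, h₁⟩ | ⟨h₀, h₁⟩ <;> rw [h₀] at hm <;> rw [h₁] at hm' <;>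
    assumption

omit hn ha in
theorem dominant_flipAt_of_branch (hK : 2 ≤ K) {x : Fin n → ℂ} (hx : ∀ k, x k ≠ 0) {p q : Fin n}
    (hpq : p ≠ q) (hiq : i ≠ q) (hmax : ∀ k, ‖x k‖ ≤ ‖x q‖) {ε : ℝ} (hε : 0 < ε)
    (hlow : ε ≤ ‖coProd x q p‖) (hi : K / ε * ‖x i‖ ≤ ‖x p‖) : Dominant K (flipAt i x) i := by
  refine dominant_flipAt hK hx hiq hmax (le_of_mul_le_mul_right ?_ (norm_pos_iff.mpr (hx i)))
  calc K * ‖x i‖ = ε * (K / ε * ‖x i‖) := by field_simp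
    _ ≤ ‖coProd x q p‖ * ‖x p‖ := mul_le_mul hlow hi (by positivity) (norm_nonneg _)
    _ = ‖coProd x i q‖ * ‖x i‖ := by
      rw [← norm_mul, ← norm_mul, coProd_mul_eq x hpq.symm hiq.symm, coProd_comm x i]

theorem IsAlternating.eventuallyGrowing_extendBy {c : ℕ → Fin n} (hc : IsAlternating c)
    (hK : 2 < K) {ρ : ℝ} (hρ : 1 < ρ) {k₀ : ℕ}
    (hgrow : ∀ k, k₀ ≤ k → ∀ i, i ≠ c (k + 1) →
      ρ * ‖pathVec a (extendBy c l k) i‖ ≤ ‖pathVec a (extendBy c l k) (c (k + 1))‖)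
    (hbranch : ∀ k, k₀ ≤ k → ∀ i, i ≠ c k → i ≠ c (k + 1) →
      Dominant K (pathVec a (i :: extendBy c l k)) i) :
    EventuallyGrowing a (extendBy c l (k₀ + 1)) := by
  have hcases : ∀ w, extendBy c l (k₀ + 1) <:+ w → Reduced w →
      (∃ k, k₀ ≤ k ∧ w = extendBy c l (k + 1)) ∨ ∃ i ∈ w.head?, Dominant K (pathVec a w) i := by
    refine suffix_induction (fun _ => .inl ⟨k₀, le_rfl, rfl⟩) fun i w _ ih hr => ?_
    rcases ih hr.tail with ⟨k, hk, rfl⟩ | hd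
    · by_cases hi : i = c (k + 1)
      · exact .inl ⟨k + 1, by omega, by rw [hi]; rfl⟩
      · have hi' := (List.isChain_cons_cons.mp hr).1
        exact .inr ⟨i, rfl, hbranch (k + 1) (by omega) i hi (by rwa [hc.periodic])⟩
    · exact .inr ⟨i, rfl, Dominant.pathVec_cons hn ha hK.le hr hd⟩
  refine ⟨min ρ (K / 2), lt_min hρ (by linarith), 0, fun w j hr hs _ i hi => ?_⟩
  rcases hcases (j :: w) (hs.trans (List.suffix_cons j w)) hr with ⟨k, hk, hw⟩ | ⟨j', hj', hd⟩
  · have hj : j = c (k + 2) := (List.cons.inj hw).1.trans (hc.periodic k).symm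
    rw [hw, hj]
    refine le_trans ?_ (hgrow (k + 1) (by omega) i (hj ▸ hi))
    gcongr
    exact min_le_left _ _
  · obtain rfl : j = j' := by simpa using hj'
    refine le_trans ?_ (hd i hi).1
    gcongr
    exact min_le_right _ _

theorem IsAlternating.eventuallyGrowing (hK : 2 < K) {c : ℕ → Fin n} (hc : IsAlternating c)
    (l : List (Fin n)) : ∃ k, EventuallyGrowing a (extendBy c l k) := by
  obtain ⟨ε, hε, hlow⟩ := exists_pos_le_norm_coProd ha
  obtain ⟨ρ, hρ, hev⟩ := (hc.isAlternatingPath_extendBy a l).exists_eventually_mul_norm_le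
    (coProd_notMem_realSegment ha l (hc.ne_succ 0)) (growthCoeff_ne_zero hn ha l (hc.ne_succ 0))
    (max 1 (K / ε))
  obtain ⟨k₀, hk₀⟩ := eventually_atTop.mp hev
  have hgrow (k : ℕ) (hk : k₀ ≤ k) (i : Fin n) (hi : i ≠ c (k + 1)) :
      ρ * ‖pathVec a (extendBy c l k) i‖ ≤ ‖pathVec a (extendBy c l k) (c (k + 1))‖ := by
    obtain ⟨hstep, hother⟩ := hk₀ k hk
    refine le_trans (mul_le_mul_of_nonneg_left ?_ (by linarith)) hstep
    rcases eq_or_ne i (c k) with rfl | hi'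
    · rfl
    · exact (le_mul_of_one_le_left (norm_nonneg _) (le_max_left _ _)).trans (hother i hi' hi)
  refine ⟨k₀ + 1, hc.eventuallyGrowing_extendBy hn ha hK hρ hgrow fun k hk i hi hi' => ?_⟩
  refine dominant_flipAt_of_branch hK.le (pathVec_ne_zero hn ha _) (hc.ne_succ k) hi'
    (fun m => ?_) hε (hlow _ _ _ (hc.ne_succ k).symm) (le_trans ?_ ((hk₀ k hk).2 i hi hi'))
  · rcases eq_or_ne m (c (k + 1)) with rfl | hm
    · rfl
    · exact (le_mul_of_one_le_left (norm_nonneg _) hρ.le).trans (hgrow k hk m hm)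
  · exact mul_le_mul_of_nonneg_right (le_max_right _ _) (norm_nonneg _)

omit hn ha in
theorem largeAfter_of_le_length {N : ℕ}
    (hN : ∀ l, Reduced l → ∀ i j, i ≠ j → ‖coProd (pathVec a l) i j‖ ≤ K →
      (l.dropWhile (· ∈ ({i, j} : Finset (Fin n)))).length < N)
    (hl : N ≤ l.length) (hlarge : ∀ i j, i ≠ j → K ≤ ‖coProd (pathVec a l) i j‖) :
    LargeAfter a K l := by
  refine fun w hr hs => suffix_induction
    (P := fun w => Reduced w → ∀ i j, i ≠ j → K ≤ ‖coProd (pathVec a w) i j‖)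
    (fun _ => hlarge) (fun r w hs ih hr i j hij => ?_) w hs hr
  by_cases hmem : r ∈ ({i, j} : Finset (Fin n))
  · rw [pathVec_cons]
    rcases mem_insert.mp hmem with rfl | hj
    · rw [coProd_flipAt]
      exact ih hr.tail r j hij
    · obtain rfl := mem_singleton.mp hj
      rw [coProd_comm, coProd_flipAt]
      exact ih hr.tail r i hij.symm
  · by_contra! hsmall
    have hlen := hN _ hr i j hij hsmall.le
    rw [List.dropWhile_cons_of_neg (by simpa using hmem), List.length_cons] at hlen
    have := hs.length_le
    omega

omit hn ha in
theorem largeAfter_or_isAlternating {N : ℕ}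
    (hN : ∀ l, Reduced l → ∀ i j, i ≠ j → ‖coProd (pathVec a l) i j‖ ≤ K →
      (l.dropWhile (· ∈ ({i, j} : Finset (Fin n)))).length < N)
    {f : ℕ → Fin n} (hf : ∀ k, f k ≠ f (k + 1)) :
    (∃ m, LargeAfter a K (extendBy f [] m)) ∨ IsAlternating fun k => f (N + k) := by
  by_cases hlarge : ∃ m, N ≤ m ∧ ∀ i j, i ≠ j → K ≤ ‖coProd (pathVec a (extendBy f [] m)) i j‖
  · obtain ⟨m, hm, hlarge⟩ := hlarge
    exact .inl ⟨m, largeAfter_of_le_length hN (by simpa [length_extendBy] using hm) hlarge⟩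
  · push Not at hlarge
    refine .inr ⟨fun k => ?_, fun k => hf (N + k)⟩
    obtain ⟨i, j, hij, hsmall⟩ := hlarge (N + k + 3) (by omega)
    have hlen := hN _ (reduced_extendBy hf (List.isChain_singleton _) _) i j hij hsmall.le
    have hmem (r : ℕ) (hr : r < 3) : f (N + k + r) = i ∨ f (N + k + r) = j := by
      simpa using mem_of_length_dropWhile_extendBy_le (p := (· ∈ ({i, j} : Finset (Fin n))))
        (by omega : N + k + r < N + k + 3) (by omega)
    have h₀ := hmem 0 (by omega)
    have h₁ := hmem 1 (by omega)
    have h₂ := hmem 2 (by omega)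
    have hf₀ := hf (N + k)
    have hf₁ := hf (N + k + 1)
    grind

theorem eventuallyGrowing_nil : EventuallyGrowing a [] := by
  have : NeZero n := ⟨by omega⟩
  obtain ⟨K, hK, N, hN⟩ := exists_length_dropWhile_lt ha
  by_contra hnil
  have hchild (l : {l : List (Fin n) // ¬ EventuallyGrowing a l}) :
      ∃ i, ¬ EventuallyGrowing a (i :: l.1) := by
    by_contra! hall
    exact l.2 (.of_cons hall)
  choose g hg using hchild
  let s (m : ℕ) : {l : List (Fin n) // ¬ EventuallyGrowing a l} :=
    Nat.rec ⟨[], hnil⟩ (fun _ l => ⟨g l :: l.1, hg l⟩) m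
  have hs (m : ℕ) : extendBy (fun m => g (s m)) [] m = (s m).1 := by
    induction m with
    | zero => rfl
    | succ m ih => rw [extendBy, ih]
  have hbad (m : ℕ) : ¬ EventuallyGrowing a (extendBy (fun m => g (s m)) [] m) := hs m ▸ (s m).2
  have hne (k : ℕ) : g (s k) ≠ g (s (k + 1)) := fun heq =>
    hbad (k + 2) (.of_not_reduced fun hr => (List.isChain_cons_cons.mp hr).1 heq.symm)
  rcases largeAfter_or_isAlternating hN hne with ⟨m, hlarge⟩ | halt
  · exact hbad m (hlarge.eventuallyGrowing hn ha hK)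
  · obtain ⟨k, hk⟩ := halt.eventuallyGrowing hn ha hK (extendBy (fun m => g (s m)) [] N)
    exact hbad (N + k) (extendBy_add _ _ N k ▸ hk)

end Growth

section UniformGrowth

variable {n : ℕ} {a : Fin n → ℂ} {ρ δ : ℝ} {N : ℕ} {i j k : Fin n} {l w : List (Fin n)}

/-- The growth of the coordinates along all long reduced words, together with a lower bound for
the partial products of the coordinates. -/
structure UniformGrowth (a : Fin n → ℂ) (ρ δ : ℝ) (N : ℕ) : Prop where
  one_lt : 1 < ρ
  pos : 0 < δ
  mul_norm_le : ∀ w j, Reduced (j :: w) → N ≤ w.length → ∀ i, i ≠ j →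
    ρ * ‖pathVec a (j :: w) i‖ ≤ ‖pathVec a (j :: w) j‖
  le_prod : ∀ l, Reduced l → ∀ s : Finset (Fin n), δ ≤ ∏ k ∈ s, ‖pathVec a l k‖

theorem exists_pos_le_norm_pathVec (hn : 3 ≤ n) (ha : a ∈ domainD n) (hρ : 1 < ρ)
    (hgrow : ∀ w j, Reduced (j :: w) → N ≤ w.length → ∀ i, i ≠ j →
      ρ * ‖pathVec a (j :: w) i‖ ≤ ‖pathVec a (j :: w) j‖) :
    ∃ m, 0 < m ∧ m ≤ 1 ∧ ∀ l, Reduced l → ∀ k, m ≤ ‖pathVec a l k‖ := by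
  obtain ⟨m, hm, hm1, hshort⟩ := exists_pos_le_of_finite
    ((finite_reducedWord_length_lt (α := Fin n) (N + 2)).prod Set.finite_univ)
    (f := fun p => ‖pathVec a p.1.1 p.2‖)
    (fun p _ => norm_pos_iff.mpr (pathVec_ne_zero hn ha p.1.1 p.2)) one_pos
  refine ⟨m, hm, hm1, fun l => ?_⟩
  induction l with
  | nil => exact fun hr k => hshort (⟨[], hr⟩, k) ⟨by simp, trivial⟩
  | cons i l ih =>
    intro hr k
    by_cases hlen : l.length < N + 1
    · exact hshort (⟨i :: l, hr⟩, k) ⟨by simpa using hlen, trivial⟩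
    rcases ne_or_eq k i with hk | rfl
    · rw [pathVec_cons, flipAt_ne _ hk]
      exact ih hr.tail k
    · obtain ⟨j, hj⟩ := exists_third hn k k
      have hstep := hgrow l k hr (by omega) j hj.1
      have hmj : m ≤ ‖pathVec a (k :: l) j‖ := by
        rw [pathVec_cons, flipAt_ne _ hj.1]
        exact ih hr.tail j
      nlinarith

theorem exists_uniformGrowth (hn : 3 ≤ n) (ha : a ∈ domainD n) :
    ∃ ρ δ N, UniformGrowth a ρ δ N := by
  obtain ⟨ρ, hρ, N, hN⟩ := eventuallyGrowing_nil hn ha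
  have hgrow : ∀ w j, Reduced (j :: w) → N ≤ w.length → ∀ i, i ≠ j →
      ρ * ‖pathVec a (j :: w) i‖ ≤ ‖pathVec a (j :: w) j‖ :=
    fun w j hr hw => hN w j hr List.nil_suffix hw
  obtain ⟨m, hm, hm1, hlow⟩ := exists_pos_le_norm_pathVec hn ha hρ hgrow
  refine ⟨ρ, m ^ n, N, hρ, by positivity, hgrow, fun l hr s => ?_⟩
  calc m ^ n ≤ m ^ #s := pow_le_pow_of_le_one hm.le hm1 (by simpa using s.card_le_univ)
    _ = ∏ _k ∈ s, m := by rw [prod_const]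
    _ ≤ ∏ k ∈ s, ‖pathVec a l k‖ := prod_le_prod (fun _ _ => hm.le) fun k _ => hlow l hr k

namespace UniformGrowth

variable (h : UniformGrowth a ρ δ N)
include h

theorem le_norm (hr : Reduced l) (k : Fin n) : δ ≤ ‖pathVec a l k‖ := by
  simpa using h.le_prod l hr {k}

theorem norm_pathVec_apply_pos (hr : Reduced l) (k : Fin n) : 0 < ‖pathVec a l k‖ :=
  h.pos.trans_le (h.le_norm hr k)

theorem mul_prod_le (hr : Reduced l) {s t : Finset (Fin n)} (hst : s ⊆ t) :
    δ * ∏ k ∈ s, ‖pathVec a l k‖ ≤ ‖∏ k ∈ t, pathVec a l k‖ := by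
  rw [norm_prod, ← prod_sdiff hst]
  gcongr
  exact h.le_prod l hr _

theorem mul_norm_le_coProd (hr : Reduced l) (hki : k ≠ i) (hkj : k ≠ j) :
    δ * ‖pathVec a l k‖ ≤ ‖coProd (pathVec a l) i j‖ := by
  rw [← prod_singleton (fun k => ‖pathVec a l k‖) k]
  exact h.mul_prod_le hr (by simp [hki, hkj])

theorem norm_pathVec (hr : Reduced (j :: w)) (hw : N ≤ w.length) :
    ‖pathVec a (j :: w)‖ = ‖pathVec a (j :: w) j‖ := by
  refine le_antisymm ((pi_norm_le_iff_of_nonneg (norm_nonneg _)).mpr fun i => ?_)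
    (norm_le_pi_norm _ j)
  rcases eq_or_ne i j with rfl | hij
  · rfl
  · exact (le_mul_of_one_le_left (norm_nonneg _) h.one_lt.le).trans
      (h.mul_norm_le w j hr hw i hij)

theorem mul_norm_le_norm_cons (hr : Reduced (i :: l)) (hl : N < l.length) :
    ρ * ‖pathVec a l‖ ≤ ‖pathVec a (i :: l)‖ := by
  obtain ⟨j, w, rfl⟩ := List.exists_cons_of_length_pos (by omega : 0 < l.length)
  have hji : j ≠ i := (List.isChain_cons_cons.mp hr).1.symm
  have hstep := h.mul_norm_le (j :: w) i hr (by omega) j hji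
  rw [pathVec_cons, flipAt_ne _ hji, ← pathVec_cons] at hstep
  rw [h.norm_pathVec hr.tail (by simpa using hl), h.norm_pathVec hr (by omega)]
  exact hstep

theorem mul_pow_le_norm [NeZero n] (r : ℕ) {l : List (Fin n)} (hr : Reduced l)
    (hl : N + r < l.length) : δ * ρ ^ r ≤ ‖pathVec a l‖ := by
  induction r generalizing l with
  | zero => simpa using (h.le_norm hr 0).trans (norm_le_pi_norm _ 0)
  | succ r ih =>
    obtain ⟨i, l, rfl⟩ := List.exists_cons_of_length_pos (by omega : 0 < l.length)
    rw [List.length_cons] at hl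
    have hρ := h.one_lt
    calc δ * ρ ^ (r + 1) = ρ * (δ * ρ ^ r) := by ring
      _ ≤ ρ * ‖pathVec a l‖ := by gcongr; exact ih hr.tail (by omega)
      _ ≤ ‖pathVec a (i :: l)‖ := h.mul_norm_le_norm_cons hr (by omega)

theorem mul_norm_le_norm_cons_of_branch (hr : Reduced (i :: j :: k :: w)) (hik : i ≠ k)
    (hw : N ≤ w.length) :
    (δ * ‖pathVec a (k :: w)‖ - 1) * ‖pathVec a (j :: k :: w)‖ ≤
      ‖pathVec a (i :: j :: k :: w)‖ := by
  have hij : i ≠ j := (List.isChain_cons_cons.mp hr).1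
  have hkj : k ≠ j := (List.isChain_cons_cons.mp hr.tail).1.symm
  have hprod := h.mul_prod_le hr.tail (s := {j, k}) (t := univ.erase i)
    (by simp [insert_subset_iff, hij.symm, hik.symm])
  rw [prod_pair hkj.symm] at hprod
  have hk : ‖pathVec a (k :: w)‖ = ‖pathVec a (j :: k :: w) k‖ := by
    rw [h.norm_pathVec hr.tail.tail hw, pathVec_cons a j, flipAt_ne _ hkj]
  have hj := h.norm_pathVec hr.tail (by simp; omega)
  calc (δ * ‖pathVec a (k :: w)‖ - 1) * ‖pathVec a (j :: k :: w)‖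
      = δ * (‖pathVec a (j :: k :: w) j‖ * ‖pathVec a (j :: k :: w) k‖)
          - ‖pathVec a (j :: k :: w)‖ := by rw [hk, hj]; ring
    _ ≤ ‖∏ s ∈ univ.erase i, pathVec a (j :: k :: w) s‖ - ‖pathVec a (j :: k :: w) i‖ :=
      sub_le_sub hprod (norm_le_pi_norm _ i)
    _ ≤ ‖pathVec a (i :: j :: k :: w) i‖ := by
      rw [pathVec_cons a i, flipAt_self_eq_prod_erase]
      exact norm_sub_norm_le _ _
    _ ≤ _ := norm_le_pi_norm _ i

theorem norm_pathVec_cons_pos (hr : Reduced (j :: l)) : 0 < ‖pathVec a (j :: l)‖ :=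
  (h.norm_pathVec_apply_pos hr j).trans_le (norm_le_pi_norm _ j)

theorem sum_inv_norm_cons_le (hr : Reduced (j :: k :: w)) (hw : N ≤ w.length) {R : ℝ} (hR : 0 < R)
    (hbig : R + 1 ≤ δ * ‖pathVec a (k :: w)‖) :
    ∑ i ∈ nextLabels (j :: k :: w), ‖pathVec a (i :: j :: k :: w)‖⁻¹ ≤
      (ρ⁻¹ + n * R⁻¹) * ‖pathVec a (j :: k :: w)‖⁻¹ := by
  have hx : 0 < ‖pathVec a (j :: k :: w)‖ := h.norm_pathVec_cons_pos hr
  have hρ : 0 < ρ := zero_lt_one.trans h.one_lt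
  have hterm : ∀ i ∈ nextLabels (j :: k :: w), ‖pathVec a (i :: j :: k :: w)‖⁻¹ ≤
      (if i = k then ρ⁻¹ * ‖pathVec a (j :: k :: w)‖⁻¹ else 0) +
        R⁻¹ * ‖pathVec a (j :: k :: w)‖⁻¹ := by
    intro i hi
    have hri : Reduced (i :: j :: k :: w) := reduced_cons.mpr ⟨hi, hr⟩
    simp only [← mul_inv]
    split_ifs with hik
    · exact le_add_of_le_of_nonneg (inv_anti₀ (by positivity)
        (h.mul_norm_le_norm_cons hri (by simp; omega))) (by positivity)
    · rw [zero_add]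
      refine inv_anti₀ (by positivity) (le_trans ?_ (h.mul_norm_le_norm_cons_of_branch hri hik hw))
      gcongr
      linarith
  refine (sum_le_sum hterm).trans ?_
  rw [sum_add_distrib, sum_ite_eq', sum_const, nsmul_eq_mul, add_mul, mul_assoc]
  refine add_le_add (by split_ifs <;> first | rfl | positivity) ?_
  gcongr
  simpa using card_le_univ (nextLabels (j :: k :: w))

theorem summable_inv_norm_pathVec [NeZero n] :
    Summable fun l : ReducedWord (Fin n) => ‖pathVec a l.1‖⁻¹ := by
  have hρ := h.one_lt
  have hδ := h.pos
  obtain ⟨R, hR, hRρ⟩ : ∃ R : ℝ, 0 < R ∧ ρ⁻¹ + n * R⁻¹ < 1 := by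
    have hlim : Tendsto (fun R : ℝ => ρ⁻¹ + n * R⁻¹) atTop (𝓝 ρ⁻¹) := by
      simpa using (tendsto_inv_atTop_zero.const_mul (n : ℝ)).const_add ρ⁻¹
    exact ((eventually_gt_atTop 0).and
      (hlim.eventually_lt_const (inv_lt_one_of_one_lt₀ hρ))).exists
  obtain ⟨r, hr⟩ := ((tendsto_pow_atTop_atTop_of_one_lt hρ).eventually_ge_atTop
    ((R + 1) / (δ * δ))).exists
  rw [div_le_iff₀ (by positivity)] at hr
  refine summable_of_sum_nextLabels_le (f := fun l => ‖pathVec a l‖⁻¹)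
    (fun l => by positivity) hRρ (N₀ := N + r + 2) fun l hl hlen => ?_
  obtain ⟨j, l, rfl⟩ := List.exists_cons_of_length_pos (by omega : 0 < l.length)
  rw [List.length_cons] at hlen
  obtain ⟨k, w, rfl⟩ := List.exists_cons_of_length_pos (by omega : 0 < l.length)
  have hk : δ * ρ ^ r ≤ ‖pathVec a (k :: w)‖ := h.mul_pow_le_norm r hl.tail (by omega)
  rw [List.length_cons] at hlen
  refine h.sum_inv_norm_cons_le hl (by omega) hR ?_
  calc R + 1 ≤ δ * (δ * ρ ^ r) := by linarith
    _ ≤ δ * ‖pathVec a (k :: w)‖ := by gcongr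

theorem norm_inv_prod_le (hr : Reduced (j :: w)) (hw : N ≤ w.length) :
    ‖(∏ k, pathVec a (j :: w) k)⁻¹‖ ≤ δ⁻¹ * ‖pathVec a (j :: w)‖⁻¹ := by
  have hδ := h.pos
  have hx := h.norm_pathVec_cons_pos hr
  rw [norm_inv, ← mul_inv]
  refine inv_anti₀ (by positivity) ?_
  rw [h.norm_pathVec hr hw, ← prod_singleton (fun k => ‖pathVec a (j :: w) k‖) j]
  exact h.mul_prod_le hr (subset_univ _)

theorem summable_inv_prod [NeZero n] :
    Summable fun l : ReducedWord (Fin n) => (∏ k, pathVec a l.1 k)⁻¹ := by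
  refine Summable.of_norm_bounded_eventually (h.summable_inv_norm_pathVec.mul_left δ⁻¹) ?_
  filter_upwards [(finite_reducedWord_length_lt (N + 1)).compl_mem_cofinite] with l hl
  obtain ⟨_ | ⟨j, w⟩, hr⟩ := l
  · simp at hl
  · exact h.norm_inv_prod_le hr (by simpa using hl)

theorem norm_hfun_coProd_le (ha : a ∈ domainD n) (hr : Reduced (j :: w)) (hw : N ≤ w.length)
    {p q : Fin n} (hpq : p ≠ q) (hp : p ≠ j) (hq : q ≠ j) :
    ‖hfun (coProd (pathVec a (j :: w)) p q)‖ ≤ 4 * δ⁻¹ ^ 3 * ‖pathVec a (j :: w)‖⁻¹ := by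
  have hδ := h.pos
  have hx := h.norm_pathVec_cons_pos hr
  have hδx : δ ≤ ‖pathVec a (j :: w)‖ := (h.le_norm hr j).trans (norm_le_pi_norm _ j)
  have hφ := h.mul_norm_le_coProd hr hp.symm hq.symm
  rw [← h.norm_pathVec hr hw] at hφ
  calc ‖hfun (coProd (pathVec a (j :: w)) p q)‖
      ≤ 4 / ‖coProd (pathVec a (j :: w)) p q‖ ^ 2 :=
        norm_hfun_le (coProd_notMem_realSegment ha _ hpq)
    _ ≤ 4 / (δ * ‖pathVec a (j :: w)‖) ^ 2 := by gcongr
    _ = 4 * δ⁻¹ ^ 2 * ‖pathVec a (j :: w)‖⁻¹ * ‖pathVec a (j :: w)‖⁻¹ := by field_simp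
    _ ≤ 4 * δ⁻¹ ^ 2 * ‖pathVec a (j :: w)‖⁻¹ * δ⁻¹ := by gcongr
    _ = 4 * δ⁻¹ ^ 3 * ‖pathVec a (j :: w)‖⁻¹ := by ring

theorem norm_coSum_le (hr : Reduced l) (i j : Fin n) :
    ‖coSum (pathVec a l) i j‖ ≤ n * (‖pathVec a l‖ * (δ⁻¹ * ‖coProd (pathVec a l) i j‖)) := by
  have hδ := h.pos
  calc ‖coSum (pathVec a l) i j‖
      ≤ ∑ k ∈ ({i, j} : Finset (Fin n))ᶜ, ‖pathVec a l k‖ ^ 2 :=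
        norm_sum_le_of_le _ fun k _ => (norm_pow _ _).le
    _ ≤ ∑ _k ∈ ({i, j} : Finset (Fin n))ᶜ,
          ‖pathVec a l‖ * (δ⁻¹ * ‖coProd (pathVec a l) i j‖) := by
      refine sum_le_sum fun k hk => ?_
      simp only [mem_compl, mem_insert, mem_singleton, not_or] at hk
      rw [sq]
      refine mul_le_mul (norm_le_pi_norm _ k) ?_ (norm_nonneg _) (norm_nonneg _)
      rw [← div_eq_inv_mul, le_div_iff₀ hδ, mul_comm]
      exact h.mul_norm_le_coProd hr hk.1 hk.2
    _ ≤ n * (‖pathVec a l‖ * (δ⁻¹ * ‖coProd (pathVec a l) i j‖)) := by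
      rw [sum_const, nsmul_eq_mul]
      gcongr
      simpa using card_le_univ ({i, j} : Finset (Fin n))ᶜ

theorem norm_tailSum_le (ha : a ∈ domainD n) (hr : Reduced (j :: w)) (hw : N ≤ w.length)
    (hij : i ≠ j) :
    ‖tailSum (pathVec a (j :: w)) i j‖ ≤
      (‖coProd (pathVec a (j :: w)) i j‖ * ((1 - ρ⁻¹) * ‖pathVec a (j :: w)‖ ^ 2))⁻¹ := by
  have hρ := h.one_lt
  have hρ' : 0 < 1 - ρ⁻¹ := sub_pos.mpr (inv_lt_one_of_one_lt₀ hρ)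
  have hφ := norm_pos_iff.mpr (coProd_ne_zero ha (j :: w) hij)
  have hx := h.norm_pathVec_apply_pos hr j
  have hb := one_lt_norm_bigRoot (coProd_notMem_realSegment ha (j :: w) hij)
  have hd : (1 - ρ⁻¹) * ‖pathVec a (j :: w) j‖ ≤ ‖growthCoeff (pathVec a (j :: w)) i j‖ := by
    have hi : ‖pathVec a (j :: w) i‖ ≤ ρ⁻¹ * ‖pathVec a (j :: w) j‖ := by
      rw [← div_eq_inv_mul, le_div_iff₀ (by linarith), mul_comm]
      exact h.mul_norm_le w j hr hw i hij
    calc (1 - ρ⁻¹) * ‖pathVec a (j :: w) j‖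
        ≤ ‖bigRoot (coProd (pathVec a (j :: w)) i j) * pathVec a (j :: w) j‖
            - ‖pathVec a (j :: w) i‖ := by rw [norm_mul]; nlinarith
      _ ≤ _ := norm_sub_norm_le _ _
  rw [tailSum, h.norm_pathVec hr hw, norm_inv, norm_mul, norm_mul]
  refine inv_anti₀ (by positivity) ?_
  calc _ = ‖coProd (pathVec a (j :: w)) i j‖ * ‖pathVec a (j :: w) j‖ *
        ((1 - ρ⁻¹) * ‖pathVec a (j :: w) j‖) := by ring
    _ ≤ _ := by gcongr

theorem norm_coSum_sub_mul_tailSum_le (ha : a ∈ domainD n) (μ : ℂ) (hr : Reduced (j :: w))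
    (hw : N ≤ w.length) (hij : i ≠ j) :
    ‖(coSum (pathVec a (j :: w)) i j - μ) * tailSum (pathVec a (j :: w)) i j‖ ≤
      (n * δ⁻¹ + ‖μ‖ * δ⁻¹ ^ 2) / (1 - ρ⁻¹) * ‖pathVec a (j :: w)‖⁻¹ := by
  have hδ := h.pos
  have hρ' : 0 < 1 - ρ⁻¹ := sub_pos.mpr (inv_lt_one_of_one_lt₀ h.one_lt)
  have hx := h.norm_pathVec_cons_pos hr
  have hδx : δ ≤ ‖pathVec a (j :: w)‖ := (h.le_norm hr j).trans (norm_le_pi_norm _ j)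
  have hδφ : δ ≤ ‖coProd (pathVec a (j :: w)) i j‖ := by
    rw [coProd, norm_prod]
    exact h.le_prod _ hr _
  have hcoSum := h.norm_coSum_le hr i j
  have htail := h.norm_tailSum_le ha hr hw hij
  rw [norm_mul]
  set X := ‖pathVec a (j :: w)‖
  set φ := ‖coProd (pathVec a (j :: w)) i j‖
  have hφ : 0 < φ := hδ.trans_le hδφ
  calc _ ≤ (n * (X * (δ⁻¹ * φ)) + ‖μ‖) * (φ * ((1 - ρ⁻¹) * X ^ 2))⁻¹ := by
        gcongr
        exact (norm_sub_le _ _).trans (by gcongr)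
    _ = (n * δ⁻¹ + ‖μ‖ * (φ⁻¹ * X⁻¹)) / (1 - ρ⁻¹) * X⁻¹ := by
        have := hρ'.ne'
        field_simp
    _ ≤ (n * δ⁻¹ + ‖μ‖ * (δ⁻¹ * δ⁻¹)) / (1 - ρ⁻¹) * X⁻¹ := by gcongr
    _ = _ := by rw [sq]

end UniformGrowth

end UniformGrowth

section LevelSums

variable {n : ℕ} {a : Fin n → ℂ} {ρ δ : ℝ} {N : ℕ}

/-- The sum of the `halfTerm`s of the alternating geodesics that contain the last edge of the path
with labels `l`. -/
noncomputable def lastEdgeSum (a : Fin n → ℂ) : List (Fin n) → ℂ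
  | [] => 0
  | j :: l => ∑ i ∈ univ.erase j, halfTerm (pathVec a (j :: l)) i j

theorem lastEdgeSum_cons (a : Fin n → ℂ) (j : Fin n) (l : List (Fin n)) :
    lastEdgeSum a (j :: l) = ∑ i ∈ univ.erase j, halfTerm (pathVec a l) j i :=
  sum_congr rfl fun i _ => by rw [pathVec_cons, halfTerm_flipAt]

theorem sum_powersetCard_hfun (ha : a ∈ domainD n) (l : List (Fin n)) :
    ∑ I ∈ (nextLabels l).powersetCard 2, hfun (∏ k ∈ Iᶜ, pathVec a l k) =
      ∑ j ∈ nextLabels l, lastEdgeSum a (j :: l) - lastEdgeSum a l := by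
  rw [sum_powersetCard_two (nextLabels l) (halfTerm (pathVec a l)) _
    fun i j hij => halfTerm_add_halfTerm _ (coProd_ne_zero ha l hij)]
  simp only [lastEdgeSum_cons]
  obtain _ | ⟨i, l⟩ := l
  · rw [nextLabels_nil, lastEdgeSum, sub_zero]
  · rw [nextLabels_cons, lastEdgeSum, ← sum_sub_distrib]
    refine sum_congr rfl fun j hj => ?_
    rw [← sum_erase_add _ _ (mem_erase.mpr ⟨(ne_of_mem_erase hj).symm, mem_univ i⟩),
      add_sub_cancel_right, erase_right_comm]

theorem sum_range_hfun (ha : a ∈ domainD n) (M : ℕ) :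
    ∑ N ∈ range M, ∑ l ∈ wordsOfLength (Fin n) N, ∑ I ∈ (nextLabels l).powersetCard 2,
      hfun (∏ k ∈ Iᶜ, pathVec a l k) = ∑ l ∈ wordsOfLength (Fin n) M, lastEdgeSum a l := by
  simp only [sum_powersetCard_hfun ha, sum_sub_distrib, ← sum_wordsOfLength_succ (lastEdgeSum a)]
  rw [← sum_sub_distrib, sum_range_sub fun N => ∑ l ∈ wordsOfLength (Fin n) N, lastEdgeSum a l,
    sum_wordsOfLength_zero, lastEdgeSum, sub_zero]

theorem sum_sq_mul_inv_prod {x : Fin n → ℂ} (hx : ∀ k, x k ≠ 0) :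
    ∑ i, x i ^ 2 * (∏ k, x k)⁻¹ = 1 + hurwitzPoly x * (∏ k, x k)⁻¹ := by
  have hprod : ∏ k, x k ≠ 0 := prod_ne_zero_iff.mpr fun k _ => hx k
  rw [← sum_mul, hurwitzPoly, sub_mul, mul_inv_cancel₀ hprod]
  ring

theorem sq_mul_inv_prod_add_flipAt {x : Fin n → ℂ} {j : Fin n}
    (hprod : ∏ k ∈ univ.erase j, x k ≠ 0) :
    x j ^ 2 * (∏ k, x k)⁻¹ + flipAt j x j ^ 2 * (∏ k, flipAt j x k)⁻¹ = 1 := by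
  have hflip : ∏ k ∈ univ.erase j, flipAt j x k = ∏ k ∈ univ.erase j, x k :=
    prod_congr rfl fun k hk => flipAt_ne x (ne_of_mem_erase hk)
  have hsum := flipAt_self_eq_prod_erase x j
  rw [← mul_prod_erase _ _ (mem_univ j), ← mul_prod_erase _ (flipAt j x) (mem_univ j), hflip]
  field_simp
  linear_combination hsum

/-- The sum of `xᵢ² / (x₁ ⋯ xₙ)` over the edges that lead from the vertex of `l` away from the
vertex `1`. -/
noncomputable def outgoingSum (a : Fin n → ℂ) (l : List (Fin n)) : ℂ :=
  ∑ i ∈ nextLabels l, pathVec a l i ^ 2 * (∏ k, pathVec a l k)⁻¹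

theorem outgoingSum_cons (hn : 3 ≤ n) (ha : a ∈ domainD n) (j : Fin n) (l : List (Fin n)) :
    outgoingSum a (j :: l) = pathVec a l j ^ 2 * (∏ k, pathVec a l k)⁻¹ +
      hurwitzPoly a * (∏ k, pathVec a (j :: l) k)⁻¹ := by
  have htotal := sum_sq_mul_inv_prod (pathVec_ne_zero hn ha (j :: l))
  have hflip := sq_mul_inv_prod_add_flipAt (x := pathVec a l) (j := j)
    (prod_ne_zero_iff.mpr fun k _ => pathVec_ne_zero hn ha l k)
  rw [hurwitzPoly_pathVec hn, ← sum_erase_add _ _ (mem_univ j)] at htotal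
  rw [outgoingSum, nextLabels_cons]
  rw [← pathVec_cons] at hflip
  linear_combination htotal - hflip

theorem sum_outgoingSum (hn : 3 ≤ n) (ha : a ∈ domainD n) (N : ℕ) :
    ∑ l ∈ wordsOfLength (Fin n) N, outgoingSum a l = 1 + hurwitzPoly a *
      ∑ M ∈ range (N + 1), ∑ l ∈ wordsOfLength (Fin n) M, (∏ k, pathVec a l k)⁻¹ := by
  induction N with
  | zero =>
    rw [zero_add, sum_range_one, sum_wordsOfLength_zero, sum_wordsOfLength_zero, outgoingSum,
      nextLabels_nil, sum_sq_mul_inv_prod (pathVec_ne_zero hn ha []), hurwitzPoly_pathVec hn]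
  | succ N ih =>
    rw [sum_range_succ, mul_add, ← add_assoc, ← ih,
      sum_wordsOfLength_succ fun l => (∏ k, pathVec a l k)⁻¹, sum_wordsOfLength_succ]
    simp only [outgoingSum_cons hn ha, sum_add_distrib, mul_sum]
    rfl

theorem outgoingSum_sub_lastEdgeSum (hn : 3 ≤ n) (ha : a ∈ domainD n) (j : Fin n)
    (l : List (Fin n)) :
    outgoingSum a (j :: l) - lastEdgeSum a (j :: l) = ∑ i ∈ univ.erase j,
      (coSum (pathVec a (j :: l)) i j - hurwitzPoly a) * tailSum (pathVec a (j :: l)) i j := by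
  rw [outgoingSum, nextLabels_cons, lastEdgeSum, ← sum_sub_distrib]
  refine sum_congr rfl fun i hi => ?_
  have hij := ne_of_mem_erase hi
  rw [sq_mul_sub_halfTerm _ hij (coProd_ne_zero ha _ hij) (pathVec_ne_zero hn ha _ j)
    (growthCoeff_ne_zero hn ha _ hij), hurwitzPoly_pathVec hn]

theorem summable_outgoingSum_sub_lastEdgeSum (hn : 3 ≤ n) (ha : a ∈ domainD n) :
    Summable fun l : ReducedWord (Fin n) => outgoingSum a l.1 - lastEdgeSum a l.1 := by
  have : NeZero n := ⟨by omega⟩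
  obtain ⟨ρ, δ, N, h⟩ := exists_uniformGrowth hn ha
  refine Summable.of_norm_bounded_eventually (h.summable_inv_norm_pathVec.mul_left
    ((n - 1 : ℕ) * ((n * δ⁻¹ + ‖hurwitzPoly a‖ * δ⁻¹ ^ 2) / (1 - ρ⁻¹)))) ?_
  filter_upwards [(finite_reducedWord_length_lt (N + 1)).compl_mem_cofinite] with l hl
  obtain ⟨_ | ⟨j, w⟩, hr⟩ := l
  · simp at hl
  rw [outgoingSum_sub_lastEdgeSum hn ha, mul_assoc, ← nsmul_eq_mul]
  refine (norm_sum_le_of_le _ fun i hi => h.norm_coSum_sub_mul_tailSum_le ha (hurwitzPoly a) hr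
    (by simpa using hl) (ne_of_mem_erase hi)).trans_eq ?_
  rw [sum_const, card_erase_of_mem (mem_univ j), card_univ, Fintype.card_fin]

theorem tendsto_sum_lastEdgeSum (hn : 3 ≤ n) (ha : a ∈ domainD n) {S : ℂ}
    (hS : HasSum (fun l : ReducedWord (Fin n) => (∏ k, pathVec a l.1 k)⁻¹) S) :
    Tendsto (fun N => ∑ l ∈ wordsOfLength (Fin n) N, lastEdgeSum a l) atTop
      (𝓝 (1 + hurwitzPoly a * S)) := by
  have herror := (hasSum_sum_wordsOfLength (f := fun l => outgoingSum a l - lastEdgeSum a l)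
    (summable_outgoingSum_sub_lastEdgeSum hn ha).hasSum).summable.tendsto_atTop_zero
  have houtgoing := ((hasSum_sum_wordsOfLength (f := fun l => (∏ k, pathVec a l k)⁻¹)
    hS).tendsto_sum_nat.comp (tendsto_add_atTop_nat 1)).const_mul (hurwitzPoly a) |>.const_add 1
  rw [← sub_zero (1 + hurwitzPoly a * S)]
  refine (houtgoing.sub herror).congr fun N => ?_
  rw [sum_sub_distrib, sum_outgoingSum hn ha]
  exact sub_sub_cancel _ _

theorem phi_rootGeod (a : Fin n → ℂ) (r : Root (Fin n)) :
    phi a (rootGeod r) = ∏ k ∈ r.2.1ᶜ, pathVec a r.1.1 k :=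
  phi_geodAt a _ _

theorem hasSum_hfun_phi (hn : 3 ≤ n) (ha : a ∈ domainD n) {S : ℂ}
    (hS : HasSum (fun l : ReducedWord (Fin n) => (∏ k, pathVec a l.1 k)⁻¹) S) :
    HasSum (fun γ : AltGeod n => hfun (phi a γ)) (1 + hurwitzPoly a * S) := by
  have : NeZero n := ⟨by omega⟩
  obtain ⟨ρ, δ, N, h⟩ := exists_uniformGrowth hn ha
  have hroot : (fun γ => hfun (phi a γ)) ∘ rootEquiv n =
      fun r => hfun (∏ k ∈ r.2.1ᶜ, pathVec a r.1.1 k) :=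
    funext fun r => congrArg hfun (phi_rootGeod a r)
  rw [← (rootEquiv n).hasSum_iff, hroot]
  refine hasSum_root (F := fun I l => hfun (∏ k ∈ Iᶜ, pathVec a l k))
    (g := fun l => 4 * δ⁻¹ ^ 3 * ‖pathVec a l‖⁻¹)
    (h.summable_inv_norm_pathVec.mul_left (4 * δ⁻¹ ^ 3)) (N₀ := N + 1) (fun l I hr hl hI => ?_) ?_
  · obtain _ | ⟨j, w⟩ := l
    · simp at hl
    obtain ⟨hI, p, q, hpq, rfl⟩ := (mem_powersetCard.trans (and_congr_right' card_eq_two)).mp hI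
    simp only [nextLabels_cons, insert_subset_iff, singleton_subset_iff, mem_erase] at hI
    exact h.norm_hfun_coProd_le ha hr (by simpa using hl) hpq hI.1.1 hI.2.1
  · simp only [sum_range_hfun ha]
    exact tendsto_sum_lastEdgeSum hn ha hS

end LevelSums

section VertexSums

variable {n : ℕ} {a : Fin n → ℂ} {c : ℕ → Fin n} {l : List (Fin n)}

theorem IsAlternating.shift (hc : IsAlternating c) : IsAlternating fun k => c (k + 1) :=
  ⟨fun k => hc.periodic (k + 1), fun k => hc.ne_succ (k + 1)⟩

theorem IsAlternating.mem (hc : IsAlternating c) (k : ℕ) : c k ∈ ({c 0, c 1} : Finset (Fin n)) := by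
  rcases hc.eq_or_eq k with h | h <;> simp [h.1]

theorem IsAlternating.eq_of_ne (hc : IsAlternating c) {i : Fin n} {k : ℕ}
    (hi : i ∈ ({c 0, c 1} : Finset (Fin n))) (hik : i ≠ c k) : i = c (k + 1) := by
  rw [mem_insert, mem_singleton] at hi
  rcases hc.eq_or_eq k with ⟨h₀, h₁⟩ | ⟨h₀, h₁⟩ <;> rw [h₁] <;> rw [h₀] at hik <;> tauto

/-- The reduced words of the vertices of the alternating geodesic with labels in `I` whose root is
the vertex of `l`. -/
def geodWords (I : Finset (Fin n)) (l : List (Fin n)) : Set (List (Fin n)) :=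
  {w | Reduced w ∧ w.dropWhile (· ∈ I) = l}

theorem extendBy_mem_geodWords {I : Finset (Fin n)} (hc : ∀ k, c k ≠ c (k + 1))
    (hmem : ∀ k, c k ∈ I) (hl : Reduced l) (hI : I ⊆ nextLabels l) (k : ℕ) :
    extendBy c l k ∈ geodWords I l := by
  refine ⟨reduced_extendBy hc (reduced_cons.mpr ⟨hI (hmem 0), hl⟩) k, ?_⟩
  induction k with
  | zero => exact dropWhile_eq_self_of_subset_nextLabels hI
  | succ k ih => rw [extendBy, List.dropWhile_cons_of_pos (by simpa using hmem k), ih]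

theorem IsAlternating.mem_range_of_mem_geodWords (hc : IsAlternating c) {w : List (Fin n)}
    (hw : w ∈ geodWords {c 0, c 1} l) :
    w ∈ Set.range (extendBy c l) ∪ Set.range fun k => extendBy (fun m => c (m + 1)) l (k + 1) := by
  obtain ⟨hr, hdrop⟩ := hw
  induction w with
  | nil => exact .inl ⟨0, hdrop.symm⟩
  | cons i w ih =>
    by_cases hi : i ∈ ({c 0, c 1} : Finset (Fin n))
    · rw [List.dropWhile_cons_of_pos (by simpa using hi)] at hdrop
      obtain ⟨_ | k, rfl⟩ | ⟨k, rfl⟩ := ih hr.tail hdrop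
      · obtain rfl | hi' := eq_or_ne i (c 0)
        · exact .inl ⟨1, rfl⟩
        · exact .inr ⟨0, by rw [hc.eq_of_ne hi hi']; rfl⟩
      · exact .inl ⟨k + 2, by rw [hc.eq_of_ne hi (List.isChain_cons_cons.mp hr).1]; rfl⟩
      · exact .inr ⟨k + 1, by rw [hc.eq_of_ne hi (List.isChain_cons_cons.mp hr).1]; rfl⟩
    · rw [List.dropWhile_cons_of_neg (by simpa using hi)] at hdrop
      exact .inl ⟨0, hdrop.symm⟩

theorem IsAlternating.geodWords_eq (hc : IsAlternating c) (hl : Reduced l)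
    (hI : {c 0, c 1} ⊆ nextLabels l) : geodWords {c 0, c 1} l =
      Set.range (extendBy c l) ∪ Set.range fun k => extendBy (fun m => c (m + 1)) l (k + 1) := by
  refine Set.Subset.antisymm (fun w => hc.mem_range_of_mem_geodWords) (Set.union_subset ?_ ?_)
  · rintro _ ⟨k, rfl⟩
    exact extendBy_mem_geodWords hc.ne_succ hc.mem hl hI k
  · rintro _ ⟨k, rfl⟩
    exact extendBy_mem_geodWords hc.shift.ne_succ (fun m => hc.mem (m + 1)) hl hI (k + 1)

theorem extendBy_injective (c : ℕ → Fin n) (l : List (Fin n)) :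
    Function.Injective (extendBy c l) := fun k m h => by
  simpa [length_extendBy] using congrArg List.length h

theorem IsAlternating.disjoint_range_extendBy (hc : IsAlternating c) (l : List (Fin n)) :
    Disjoint (Set.range (extendBy c l))
      (Set.range fun k => extendBy (fun m => c (m + 1)) l (k + 1)) := by
  rw [Set.disjoint_left]
  rintro _ ⟨k, rfl⟩ ⟨m, h⟩
  obtain rfl : m + 1 = k := by simpa [length_extendBy] using congrArg List.length h
  exact hc.ne_succ m (List.cons.inj h).1.symm

theorem IsAlternating.hasSum_extendBy (hn : 3 ≤ n) (ha : a ∈ domainD n) (hc : IsAlternating c)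
    (l : List (Fin n)) :
    HasSum (fun k => (∏ m, pathVec a (extendBy c l (k + 1)) m)⁻¹)
      (tailSum (pathVec a l) (c 0) (c 1)) :=
  (hc.isAlternatingPath_extendBy a l).hasSum_inv_prod
    (coProd_notMem_realSegment ha l (hc.ne_succ 0)) (growthCoeff_ne_zero hn ha l (hc.ne_succ 0))
    fun _ => pathVec_ne_zero hn ha _

theorem hasSum_geodWords (hn : 3 ≤ n) (ha : a ∈ domainD n) {i j : Fin n} (hij : i ≠ j)
    (hl : Reduced l) (hI : {i, j} ⊆ nextLabels l) :
    HasSum (fun w : geodWords {i, j} l => (∏ m, pathVec a w.1 m)⁻¹)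
      (csqrt (1 - 4 / coProd (pathVec a l) i j ^ 2) /
        (coSum (pathVec a l) i j - hurwitzPoly a)) := by
  obtain ⟨c, hc, rfl, rfl⟩ := exists_isAlternating hij
  rw [← hurwitzPoly_pathVec hn a l, csqrt_div_eq_add_tailSum _ hij (coProd_ne_zero ha l hij)
    (pathVec_ne_zero hn ha l _) (pathVec_ne_zero hn ha l _) (growthCoeff_ne_zero hn ha l hij)
    (growthCoeff_ne_zero hn ha l hij.symm), hc.geodWords_eq hl hI]
  let f (w : List (Fin n)) : ℂ := (∏ m, pathVec a w m)⁻¹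
  have hforward : HasSum (f ∘ extendBy c l) (f l + tailSum (pathVec a l) (c 0) (c 1)) :=
    HasSum.zero_add (f := fun k => f (extendBy c l k)) (hc.hasSum_extendBy hn ha l)
  have hbackward : HasSum (f ∘ fun k => extendBy (fun m => c (m + 1)) l (k + 1))
      (tailSum (pathVec a l) (c 1) (c 0)) := by
    rw [← hc.periodic 0]
    exact hc.shift.hasSum_extendBy hn ha l
  exact HasSum.add_disjoint (f := f) (hc.disjoint_range_extendBy l)
    ((extendBy_injective c l).hasSum_range_iff.mpr hforward)
    (((extendBy_injective _ l).comp (add_left_injective 1)).hasSum_range_iff.mpr hbackward)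

/-- The words of the vertices of the alternating geodesic with root `r`, as a fibre of `rootOf`. -/
noncomputable def geodWordsEquiv (r : Root (Fin n)) :
    geodWords r.2.1 r.1.1 ≃ {p // rootOf (n := n) p = r} :=
  Equiv.ofBijective
    (fun w => ⟨(⟨r.2.1, (mem_powersetCard.mp r.2.2).2⟩, ⟨w.1, w.2.1⟩),
      Sigma.subtype_ext (Subtype.ext w.2.2) rfl⟩)
    ⟨fun w w' h => Subtype.ext (congrArg (fun p => p.1.2.1) h), by
      rintro ⟨⟨I, w⟩, rfl⟩
      exact ⟨⟨w.1, w.2, rfl⟩, rfl⟩⟩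

theorem sigma_rootGeod (a : Fin n → ℂ) (r : Root (Fin n)) :
    sigma a (rootGeod r) = ∑ k ∈ r.2.1ᶜ, pathVec a r.1.1 k ^ 2 :=
  sigma_geodAt a _ _

theorem hasSum_rootOf_fiber (hn : 3 ≤ n) (ha : a ∈ domainD n) (r : Root (Fin n)) :
    HasSum (fun p : {p // rootOf (n := n) p = r} => (∏ k, pathVec a p.1.2.1 k)⁻¹)
      (csqrt (1 - 4 / phi a (rootGeod r) ^ 2) / (sigma a (rootGeod r) - hurwitzPoly a)) := by
  rw [← (geodWordsEquiv r).hasSum_iff, phi_rootGeod, sigma_rootGeod]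
  obtain ⟨⟨l, hl⟩, I, hI⟩ := r
  obtain ⟨hI, i, j, hij, rfl⟩ := (mem_powersetCard.trans (and_congr_right' card_eq_two)).mp hI
  exact hasSum_geodWords hn ha hij hl hI

theorem natCast_card_pairs (n : ℕ) :
    (Fintype.card {I : Finset (Fin n) // I.card = 2} : ℂ) = n * (n - 1) / 2 := by
  rw [Fintype.card_finset_len, Fintype.card_fin, Nat.cast_choose_two]

/-- Every vertex lies on `n(n-1)/2` alternating geodesics, and the summand on the left is the sum
of `1 / (x₁ ⋯ xₙ)` over the vertices of the geodesic. -/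
theorem hasSum_csqrt_div (hn : 3 ≤ n) (ha : a ∈ domainD n) {S : ℂ}
    (hS : HasSum (fun l : ReducedWord (Fin n) => (∏ k, pathVec a l.1 k)⁻¹) S) :
    HasSum (fun γ : AltGeod n =>
      csqrt (1 - 4 / phi a γ ^ 2) / (sigma a γ - hurwitzPoly a)) (n * (n - 1) / 2 * S) := by
  have hpairs : HasSum (fun p : {I : Finset (Fin n) // I.card = 2} × ReducedWord (Fin n) =>
      (∏ k, pathVec a p.2.1 k)⁻¹) (n * (n - 1) / 2 * S) := by
    rw [← natCast_card_pairs, ← nsmul_eq_mul]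
    exact hasSum_comp_snd hS
  have hfibers : HasSum (fun r : Root (Fin n) => csqrt (1 - 4 / phi a (rootGeod r) ^ 2) /
      (sigma a (rootGeod r) - hurwitzPoly a)) (n * (n - 1) / 2 * S) :=
    ((Equiv.sigmaFiberEquiv rootOf).hasSum_iff.mpr hpairs).sigma (hasSum_rootOf_fiber hn ha)
  exact (rootEquiv n).hasSum_iff.mp hfibers

end VertexSums

section Main

variable {n : ℕ} {a : Fin n → ℂ}

theorem sigma_ne_hurwitzPoly (hn : 3 ≤ n) (ha : a ∈ domainD n) (γ : AltGeod n) :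
    sigma a γ ≠ hurwitzPoly a := by
  obtain ⟨⟨⟨l, hl⟩, I, hI⟩, rfl⟩ := rootGeod_bijective.2 γ
  obtain ⟨-, i, j, hij, rfl⟩ := (mem_powersetCard.trans (and_congr_right' card_eq_two)).mp hI
  rw [sigma_rootGeod, ← hurwitzPoly_pathVec hn a l]
  exact sub_ne_zero.mp (coSum_sub_ne_zero hn ha l hij)

theorem hmu_eq_sub (μ : ℂ) (a : Fin n → ℂ) (γ : AltGeod n) :
    hmu μ a γ = hfun (phi a γ) -
      2 * μ / (n * (n - 1)) * (csqrt (1 - 4 / phi a γ ^ 2) / (sigma a γ - μ)) := by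
  rw [hmu, hfun, ← div_div]
  ring

theorem hasSum_hmu (hn : 3 ≤ n) (ha : a ∈ domainD n) {S : ℂ}
    (hS : HasSum (fun l : ReducedWord (Fin n) => (∏ k, pathVec a l.1 k)⁻¹) S) :
    HasSum (fun γ => hmu (hurwitzPoly a) a γ) 1 := by
  have hn₀ : (n : ℂ) ≠ 0 := Nat.cast_ne_zero.mpr (by lia)
  have hn₁ : (n : ℂ) - 1 ≠ 0 := sub_ne_zero.mpr (Nat.cast_ne_one.mpr (by lia))
  have hsub := (hasSum_hfun_phi hn ha hS).sub
    ((hasSum_csqrt_div hn ha hS).mul_left (2 * hurwitzPoly a / (n * (n - 1))))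
  have hval : 1 + hurwitzPoly a * S -
      2 * hurwitzPoly a / (n * (n - 1)) * (n * (n - 1) / 2 * S) = 1 := by
    field_simp
    ring
  simpa only [hmu_eq_sub, hval] using hsub

end Main

end MarkoffHurwitz

theorem theorem1p5 (n : ℕ) (hn : 3 ≤ n) (μ : ℂ) (a : Fin n → ℂ)
    (ha : a ∈ MarkoffHurwitz.domainD n) (hμ : MarkoffHurwitz.hurwitzPoly a = μ) :
    (∀ γ : MarkoffHurwitz.AltGeod n, MarkoffHurwitz.sigma a γ ≠ μ) ∧
    (Summable fun γ : MarkoffHurwitz.AltGeod n => ‖MarkoffHurwitz.hmu μ a γ‖) ∧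
    HasSum (fun γ : MarkoffHurwitz.AltGeod n => MarkoffHurwitz.hmu μ a γ) 1 ∧
    (μ = 0 →
      (Summable fun γ : MarkoffHurwitz.AltGeod n =>
        ‖MarkoffHurwitz.hfun (MarkoffHurwitz.phi a γ)‖) ∧
      HasSum (fun γ : MarkoffHurwitz.AltGeod n =>
        MarkoffHurwitz.hfun (MarkoffHurwitz.phi a γ)) 1) := by
  have : NeZero n := ⟨by lia⟩
  obtain ⟨ρ, δ, N, hgrowth⟩ := MarkoffHurwitz.exists_uniformGrowth hn ha
  have hvertex := hgrowth.summable_inv_prod.hasSum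
  have hmuSum := MarkoffHurwitz.hasSum_hmu hn ha hvertex
  subst hμ
  refine ⟨MarkoffHurwitz.sigma_ne_hurwitzPoly hn ha, hmuSum.summable.norm, hmuSum, fun hμ => ?_⟩
  have hphiSum := MarkoffHurwitz.hasSum_hfun_phi hn ha hvertex
  rw [hμ, zero_mul, add_zero] at hphiSum
  exact ⟨hphiSum.summable.norm, hphiSum⟩
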